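/- Conventions. An operator space is a complex Banach space $E$ with norms $\|\cdot\|_n$ on $M_n(E)$, $n\in\mathbb N$, that satisfy Ruan's axioms and extend the norm of $E=M_1(E)$. For operator spaces $E,F$ the Haagerup tensor product $E\otimes_h F$ is the completion of the algebraic tensor product with respect to the matrix norms $\|u\|_n=\inf\{\|x\|\,\|y\| : u=x\odot y,\ x\in M_{n,p}(E),\ y\in M_{p,n}(F),\ p\in\mathbb N\}$, where $(x\odot y)_{ij}=\sum_k x_{ik}\otimes y_{kj}$. A unital operator algebra $A$ is an operator space that is a unital Banach algebra with $\|1\|\le 1$ whose multiplication induces a complete contraction $A\otimes_h A\to A$. A right operator $A$-module is an operator space $E$ that is a unital right $A$-module whose action induces a complete contraction $E\otimes_h A\to E$. $\mathcal{OMOD}_A$ is the category of right operator $A$-modules and completely bounded $A$-module maps, and $\mathcal{O}p$ is the category of operator spaces and completely bounded linear maps. A kernel-cokernel pair in $\mathcal{OMOD}_A$ is a pair $(\mu,\pi)$ of composable morphisms such that $\mu$ is a kernel of $\pi$ and $\pi$ is a cokernel of $\mu$. $\mathcal{E}_{rel}$ is the class of all kernel-cokernel pairs $K\xrightarrow{\mu}E\xrightarrow{\pi}C$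 in $\mathcal{OMOD}_A$ that split in $\mathcal{O}p$, that is, for which there are completely bounded linear maps $\rho\colon E\to K$ and $\sigma\colon C\to E$ with $\rho\mu=\mathrm{id}_K$, $\pi\sigma=\mathrm{id}_C$ and $\mu\rho+\sigma\pi=\mathrm{id}_E$. $\mathcal{P}_{rel}$ is the class of admissible epimorphisms of $\mathcal{E}_{rel}$, that is, of the morphisms $\pi$ with $(\mu,\pi)\in\mathcal{E}_{rel}$ for some $\mu$. An object $X$ of $\mathcal{OMOD}_A$ is $\mathcal{P}_{rel}$-projective if for every $\pi\colon F\to G$ in $\mathcal{P}_{rel}$ and every morphism $f\colon X\to G$ there is a morphism $g\colon X\to F$ with $\pi g=f$. Proposition. Let $A$ be a unital operator algebra. 1. For every operator space $E$, the right operator $A$-module $E\otimes_h A$ with the action $(x\otimes a)\cdot b=x\otimes ab$ is $\mathcal{P}_{rel}$-projective. 2. For every right operator $A$-module $E$ there is a morphism $P\colon E\otimes_h A\to E$ in $\mathcal{OMOD}_A$ with $P(x\otimes a)=x\cdot a$ for all $x\in E$, $a\in A$, and $P\in\mathcal{P}_{rel}$. 3. $(\mathcal{OMOD}_A,\mathcal{E}_{rel})$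 has enough $\mathcal{P}_{rel}$-projectives: for every object $E$ of $\mathcal{OMOD}_A$ there are a $\mathcal{P}_{rel}$-projective object $X$ and a morphism $X\to E$ in $\mathcal{P}_{rel}$. -/

import Mathlib

open TensorProduct


universe u v w

namespace OperatorModules

section Scalars

open scoped Matrix.Norms.L2Operator

variable {ι κ : Type} [Fintype ι] [Fintype κ] [DecidableEq ι] [DecidableEq κ]

/-- The operator norm of a rectangular complex matrix, as a map between Euclidean spaces. -/
noncomputable def opNorm (α : Matrix ι κ ℂ) : ℝ := ‖α‖

theorem opNorm_nonneg (α : Matrix ι κ ℂ) : 0 ≤ opNorm α := norm_nonneg _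

theorem opNorm_mul {l : Type} [Fintype l] [DecidableEq l] (α : Matrix ι κ ℂ) (β : Matrix κ l ℂ) :
    opNorm (α * β) ≤ opNorm α * opNorm β := Matrix.l2_opNorm_mul α β

theorem opNorm_zero : opNorm (0 : Matrix ι κ ℂ) = 0 := norm_zero

theorem opNorm_one_le : opNorm (1 : Matrix ι ι ℂ) ≤ 1 := by
  unfold opNorm
  rw [← Matrix.diagonal_one, Matrix.l2_opNorm_diagonal]
  exact (pi_norm_le_iff_of_nonneg zero_le_one).2 fun i => by simp

theorem opNorm_smul (c : ℂ) (α : Matrix ι κ ℂ) : opNorm (c • α) = ‖c‖ * opNorm α :=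
  norm_smul c α

theorem opNorm_conjTranspose (α : Matrix ι κ ℂ) : opNorm α.conjTranspose = opNorm α :=
  Matrix.l2_opNorm_conjTranspose α

theorem opNorm_le_of_conjTranspose_mul {α : Matrix ι κ ℂ} {s : ℝ} (hs : 0 ≤ s)
    (h : opNorm (α.conjTranspose * α) ≤ s ^ 2) : opNorm α ≤ s := by
  unfold opNorm at *
  rw [Matrix.l2_opNorm_conjTranspose_mul_self] at h
  nlinarith [norm_nonneg α]

theorem opNorm_le_of_mul_conjTranspose {α : Matrix ι κ ℂ} {s : ℝ} (hs : 0 ≤ s)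
    (h : opNorm (α * α.conjTranspose) ≤ s ^ 2) : opNorm α ≤ s := by
  rw [← opNorm_conjTranspose]
  apply opNorm_le_of_conjTranspose_mul hs
  rwa [Matrix.conjTranspose_conjTranspose]

/-- The matrix of an injection of index sets. -/
noncomputable def sel (f : ι → κ) : Matrix ι κ ℂ := (1 : Matrix κ κ ℂ).submatrix f id

theorem sel_apply (f : ι → κ) (i : ι) (k : κ) : sel f i k = if f i = k then 1 else 0 := by
  simp [sel, Matrix.one_apply]

theorem opNorm_sel_le {f : ι → κ} (hf : Function.Injective f) : opNorm (sel f) ≤ 1 := by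
  apply opNorm_le_of_mul_conjTranspose zero_le_one
  have : sel f * (sel f).conjTranspose = (1 : Matrix ι ι ℂ) := by
    ext i j
    simp [Matrix.mul_apply, sel_apply, Matrix.one_apply, hf.eq_iff, eq_comm]
  rw [this]
  simpa using opNorm_one_le

theorem opNorm_selT_le {f : ι → κ} (hf : Function.Injective f) :
    opNorm (sel f).conjTranspose ≤ 1 := by
  rw [opNorm_conjTranspose]
  exact opNorm_sel_le hf

end Scalars

section Ruan

/-- `lr α x β` is the product `α x β` of a matrix `x` over a complex vector space with complex
matrices `α` (on the left) and `β` (on the right). -/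
noncomputable def lr {E : Type*} [AddCommGroup E] [Module ℂ E] {ι' ι κ κ' : Type} [Fintype ι]
    [Fintype κ] (α : Matrix ι' ι ℂ) (x : Matrix ι κ E) (β : Matrix κ κ' ℂ) : Matrix ι' κ' E :=
  Matrix.of fun i j => ∑ k, ∑ l, (α i k * β l j) • x k l

/-- The direct sum `x ⊕ y ∈ M_{m+n}(E)` of `x ∈ M_m(E)` and `y ∈ M_n(E)`. -/
def dsum {E : Type*} [Zero E] {m n : ℕ} (x : Matrix (Fin m) (Fin m) E)
    (y : Matrix (Fin n) (Fin n) E) : Matrix (Fin (m + n)) (Fin (m + n)) E :=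
  (Matrix.fromBlocks x 0 0 y).submatrix finSumFinEquiv.symm finSumFinEquiv.symm

/-- Matrix norms `‖·‖ₙ` on `M_n(E)`, `n ∈ ℕ`, that satisfy Ruan's axioms and extend the
norm of `E = M_1(E)`. That each `‖·‖ₙ` is a seminorm, and a norm if the norm of `E` is one,
follows from the axioms. An operator space is a Banach space with such matrix norms. -/
class MatrixNormed (E : Type*) [SeminormedAddCommGroup E] [NormedSpace ℂ E] where
  mnorm : ∀ {n : ℕ}, Matrix (Fin n) (Fin n) E → ℝ
  mnorm_one : ∀ x : Matrix (Fin 1) (Fin 1) E, mnorm x = ‖x 0 0‖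
  mnorm_add_le : ∀ {n : ℕ} (x y : Matrix (Fin n) (Fin n) E), mnorm (x + y) ≤ mnorm x + mnorm y
  mnorm_lr_le : ∀ {m n : ℕ} (α : Matrix (Fin n) (Fin m) ℂ) (x : Matrix (Fin m) (Fin m) E)
    (β : Matrix (Fin m) (Fin n) ℂ), mnorm (lr α x β) ≤ opNorm α * mnorm x * opNorm β
  mnorm_dsum : ∀ {m n : ℕ} (x : Matrix (Fin m) (Fin m) E) (y : Matrix (Fin n) (Fin n) E),
    mnorm (dsum x y) = max (mnorm x) (mnorm y)

open MatrixNormed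


section Algebra

variable {E : Type*} [AddCommGroup E] [Module ℂ E]
variable {ι ι' ι'' κ κ' κ'' : Type} [Fintype ι] [Fintype ι'] [Fintype ι''] [Fintype κ] [Fintype κ']
  [Fintype κ''] [DecidableEq ι] [DecidableEq ι'] [DecidableEq ι''] [DecidableEq κ] [DecidableEq κ']
  [DecidableEq κ'']

theorem lr_apply (α : Matrix ι' ι ℂ) (x : Matrix ι κ E) (β : Matrix κ κ' ℂ) (i : ι') (j : κ') :
    lr α x β i j = ∑ k, ∑ l, (α i k * β l j) • x k l := rfl

theorem lr_lr (α : Matrix ι'' ι' ℂ) (α' : Matrix ι' ι ℂ) (x : Matrix ι κ E) (β' : Matrix κ κ' ℂ)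
    (β : Matrix κ' κ'' ℂ) : lr α (lr α' x β') β = lr (α * α') x (β' * β) := by
  ext i j
  simp only [lr_apply, Matrix.mul_apply, Finset.smul_sum, Finset.sum_mul, Finset.mul_sum,
    Finset.sum_smul, smul_smul]
  have h1 : ∀ k : ι', (∑ l : κ', ∑ a : ι, ∑ b : κ, (α i k * β l j * (α' k a * β' b l)) • x a b)
      = ∑ a : ι, ∑ b : κ, ∑ l : κ', (α i k * β l j * (α' k a * β' b l)) • x a b := by
    intro k
    rw [Finset.sum_comm]
    exact Finset.sum_congr rfl fun a _ => Finset.sum_comm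
  simp only [h1]
  rw [Finset.sum_comm]
  refine Finset.sum_congr rfl fun a _ => ?_
  rw [Finset.sum_comm]
  refine Finset.sum_congr rfl fun b _ => ?_
  rw [Finset.sum_comm]
  refine Finset.sum_congr rfl fun l _ => Finset.sum_congr rfl fun k _ => ?_
  congr 1
  ring

theorem lr_sel (f : ι' → ι) (g : κ' → κ) (x : Matrix ι κ E) :
    lr (sel f) x (sel g).conjTranspose = x.submatrix f g := by
  ext i j
  simp [lr_apply, sel_apply, Matrix.conjTranspose_apply, ite_smul]

theorem lr_one_one (x : Matrix ι κ E) : lr 1 x 1 = x := by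
  ext i j
  simp [lr_apply, Matrix.one_apply, ite_smul]

theorem lr_add (α : Matrix ι' ι ℂ) (x y : Matrix ι κ E) (β : Matrix κ κ' ℂ) :
    lr α (x + y) β = lr α x β + lr α y β := by
  ext i j
  simp [lr_apply, Finset.sum_add_distrib]

theorem lr_smul_left (c : ℂ) (α : Matrix ι' ι ℂ) (x : Matrix ι κ E) (β : Matrix κ κ' ℂ) :
    lr (c • α) x β = c • lr α x β := by
  ext i j
  simp [lr_apply, Finset.smul_sum, smul_smul, mul_assoc]

theorem lr_map {F : Type*} [AddCommGroup F] [Module ℂ F] (f : E →ₗ[ℂ] F)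
    (α : Matrix ι' ι ℂ) (x : Matrix ι κ E) (β : Matrix κ κ' ℂ) :
    (lr α x β).map f = lr α (x.map f) β := by
  ext i j
  simp [lr_apply, map_sum]

theorem lr_one_right (α : Matrix ι' ι ℂ) (x : Matrix ι κ E) (i : ι') (k : κ) :
    lr α x (1 : Matrix κ κ ℂ) i k = ∑ a, α i a • x a k := by
  simp [lr_apply, Matrix.one_apply, ite_smul]

theorem lr_one_left (x : Matrix ι κ E) (β : Matrix κ κ' ℂ) (i : ι) (k : κ') :
    lr (1 : Matrix ι ι ℂ) x β i k = ∑ a, β a k • x i a := by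
  simp [lr_apply, Matrix.one_apply, ite_smul]

end Algebra

variable {E : Type*} [SeminormedAddCommGroup E] [NormedSpace ℂ E]
variable {ι ι' ι'' κ κ' κ'' : Type} [Fintype ι] [Fintype ι'] [Fintype ι''] [Fintype κ] [Fintype κ']
  [Fintype κ''] [DecidableEq ι] [DecidableEq ι'] [DecidableEq ι''] [DecidableEq κ] [DecidableEq κ']
  [DecidableEq κ'']

/-- The square matrix obtained from a rectangular one by adding zero rows and columns. -/
noncomputable def pad {E : Type*} [Zero E] {ι κ : Type} [Fintype ι] [Fintype κ]
    (x : Matrix ι κ E) :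
    Matrix (Fin (Fintype.card (ι ⊕ κ))) (Fin (Fintype.card (ι ⊕ κ))) E :=
  (Matrix.fromBlocks (0 : Matrix ι ι E) x 0 (0 : Matrix κ κ E)).submatrix
    (Fintype.equivFin (ι ⊕ κ)).symm (Fintype.equivFin (ι ⊕ κ)).symm

/-- The norm of a rectangular matrix over an operator space: the norm of the square matrix
obtained from it by adding zero rows and columns. -/
noncomputable def rnorm {E : Type*} [SeminormedAddCommGroup E] [NormedSpace ℂ E] [MatrixNormed E]
    {ι κ : Type} [Fintype ι] [Fintype κ] (x : Matrix ι κ E) : ℝ := mnorm (pad x)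

theorem pad_inl_inr (x : Matrix ι κ E) :
    (pad x).submatrix (fun i => Fintype.equivFin (ι ⊕ κ) (Sum.inl i))
      (fun j => Fintype.equivFin (ι ⊕ κ) (Sum.inr j)) = x := by
  ext i j
  simp [pad]

theorem pad_eq_lr (x : Matrix ι κ E) :
    pad x = lr (sel (fun i => Fintype.equivFin (ι ⊕ κ) (Sum.inl i))).conjTranspose x
      (sel (fun j => Fintype.equivFin (ι ⊕ κ) (Sum.inr j))) := by
  ext a b
  obtain ⟨a, rfl⟩ := (Fintype.equivFin (ι ⊕ κ)).surjective a
  obtain ⟨b, rfl⟩ := (Fintype.equivFin (ι ⊕ κ)).surjective b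
  rcases a with a | a <;> rcases b with b | b <;>
    simp [pad, lr_apply, sel_apply, Matrix.conjTranspose_apply, ite_smul]

theorem pad_add (x y : Matrix ι κ E) : pad (x + y) = pad x + pad y := by
  rw [pad_eq_lr, lr_add, ← pad_eq_lr, ← pad_eq_lr]

theorem injL : Function.Injective (fun i : ι => Fintype.equivFin (ι ⊕ κ) (Sum.inl i)) :=
  (Fintype.equivFin _).injective.comp Sum.inl_injective

theorem injR : Function.Injective (fun i : κ => Fintype.equivFin (ι ⊕ κ) (Sum.inr i)) :=
  (Fintype.equivFin _).injective.comp Sum.inr_injective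

variable [MatrixNormed E]

theorem mnorm_zero {n : ℕ} : mnorm (0 : Matrix (Fin n) (Fin n) E) = 0 := by
  have h1 : mnorm (0 : Matrix (Fin n) (Fin n) E) ≤ 0 := by
    have := mnorm_lr_le (0 : Matrix (Fin n) (Fin n) ℂ) (0 : Matrix (Fin n) (Fin n) E) 1
    have h0 : lr (0 : Matrix (Fin n) (Fin n) ℂ) (0 : Matrix (Fin n) (Fin n) E)
      (1 : Matrix (Fin n) (Fin n) ℂ) = 0 := by
      ext i j; simp [lr_apply]
    rw [h0, opNorm_zero] at this
    linarith
  have h2 := mnorm_add_le (0 : Matrix (Fin n) (Fin n) E) 0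
  rw [add_zero] at h2
  linarith

theorem mnorm_nonneg {n : ℕ} (x : Matrix (Fin n) (Fin n) E) : 0 ≤ mnorm x := by
  have h := mnorm_add_le x (-x)
  rw [add_neg_cancel, mnorm_zero] at h
  have key := mnorm_lr_le ((-1 : ℂ) • (1 : Matrix (Fin n) (Fin n) ℂ)) x 1
  rw [lr_smul_left, lr_one_one, opNorm_smul] at key
  simp only [neg_smul, one_smul, norm_neg, norm_one, one_mul] at key
  by_contra! hx
  have h2 := opNorm_nonneg (1 : Matrix (Fin n) (Fin n) ℂ)
  have h3 := mul_nonneg h2 h2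
  nlinarith

theorem rnorm_nonneg (x : Matrix ι κ E) : 0 ≤ rnorm x := mnorm_nonneg _

theorem rnorm_add_le (x y : Matrix ι κ E) : rnorm (x + y) ≤ rnorm x + rnorm y := by
  unfold rnorm
  rw [pad_add]
  exact mnorm_add_le _ _

theorem rnorm_lr_le (α : Matrix ι' ι ℂ) (x : Matrix ι κ E) (β : Matrix κ κ' ℂ) :
    rnorm (lr α x β) ≤ opNorm α * rnorm x * opNorm β := by
  have key : pad (lr α x β) =
      lr ((sel (fun i => Fintype.equivFin (ι' ⊕ κ') (Sum.inl i))).conjTranspose *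
          (α * sel (fun i => Fintype.equivFin (ι ⊕ κ) (Sum.inl i)))) (pad x)
        (((sel (fun i => Fintype.equivFin (ι ⊕ κ) (Sum.inr i))).conjTranspose * β) *
          sel (fun i => Fintype.equivFin (ι' ⊕ κ') (Sum.inr i))) := by
    rw [pad_eq_lr (lr α x β), ← lr_lr, ← lr_lr, lr_sel, pad_inl_inr]
  have hx := mnorm_nonneg (pad x)
  have hα := opNorm_nonneg α
  have hβ := opNorm_nonneg β
  have h1 : opNorm ((sel (fun i => Fintype.equivFin (ι' ⊕ κ') (Sum.inl i))).conjTranspose *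
      (α * sel (fun i => Fintype.equivFin (ι ⊕ κ) (Sum.inl i)))) ≤ opNorm α :=
    (opNorm_mul _ _).trans ((mul_le_of_le_one_left (opNorm_nonneg _)
      (opNorm_selT_le injL)).trans ((opNorm_mul _ _).trans
        (mul_le_of_le_one_right hα (opNorm_sel_le injL))))
  have h2 : opNorm (((sel (fun i => Fintype.equivFin (ι ⊕ κ) (Sum.inr i))).conjTranspose * β) *
      sel (fun i => Fintype.equivFin (ι' ⊕ κ') (Sum.inr i))) ≤ opNorm β :=
    (opNorm_mul _ _).trans ((mul_le_of_le_one_right (opNorm_nonneg _)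
      (opNorm_sel_le injR)).trans ((opNorm_mul _ _).trans
        (mul_le_of_le_one_left hβ (opNorm_selT_le injR))))
  unfold rnorm
  rw [key]
  refine (mnorm_lr_le _ _ _).trans ?_
  exact mul_le_mul (mul_le_mul_of_nonneg_right h1 hx) h2 (opNorm_nonneg _) (by positivity)

theorem rnorm_lr_le_of_le_one {α : Matrix ι' ι ℂ} (x : Matrix ι κ E) {β : Matrix κ κ' ℂ}
    (hα : opNorm α ≤ 1) (hβ : opNorm β ≤ 1) : rnorm (lr α x β) ≤ rnorm x := by
  refine (rnorm_lr_le _ _ _).trans ?_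
  have hx := rnorm_nonneg x
  have h1 := opNorm_nonneg α
  have h2 := opNorm_nonneg β
  calc _ ≤ 1 * rnorm x * 1 := by gcongr
    _ = _ := by ring

theorem rnorm_eq_mnorm {n : ℕ} (x : Matrix (Fin n) (Fin n) E) : rnorm x = mnorm x := by
  have one : ∀ {a b : ℝ} {c : ℝ}, 0 ≤ a → 0 ≤ b → 0 ≤ c → a ≤ 1 → b ≤ 1 → a * c * b ≤ c := by
    intro a b c ha hb hc h1 h2
    calc _ ≤ 1 * c * 1 := by gcongr
      _ = _ := by ring
  apply le_antisymm
  · unfold rnorm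
    rw [pad_eq_lr]
    exact (mnorm_lr_le _ _ _).trans (one (opNorm_nonneg _) (opNorm_nonneg _) (mnorm_nonneg _)
      (opNorm_selT_le injL) (opNorm_sel_le injR))
  · unfold rnorm
    conv_lhs => rw [← pad_inl_inr x, ← lr_sel]
    exact (mnorm_lr_le _ _ _).trans (one (opNorm_nonneg _) (opNorm_nonneg _) (mnorm_nonneg _)
      (opNorm_sel_le injL) (opNorm_selT_le injR))

theorem rnorm_submatrix_le (x : Matrix ι κ E) {f : ι' → ι} {g : κ' → κ}
    (hf : Function.Injective f) (hg : Function.Injective g) :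
    rnorm (x.submatrix f g) ≤ rnorm x := by
  rw [← lr_sel]
  exact rnorm_lr_le_of_le_one _ (opNorm_sel_le hf) (opNorm_selT_le hg)

theorem rnorm_submatrix_equiv (x : Matrix ι κ E) (f : ι' ≃ ι) (g : κ' ≃ κ) :
    rnorm (x.submatrix f g) = rnorm x := by
  apply le_antisymm (rnorm_submatrix_le x f.injective g.injective)
  have := rnorm_submatrix_le (x.submatrix f g) f.symm.injective g.symm.injective
  simpa using this

theorem rnorm_zero : rnorm (0 : Matrix ι κ E) = 0 := by
  have : pad (0 : Matrix ι κ E) = 0 := by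
    rw [pad_eq_lr]; ext i j; simp [lr_apply]
  rw [rnorm, this, mnorm_zero]

theorem rnorm_smul_le (c : ℂ) (x : Matrix ι κ E) : rnorm (c • x) ≤ ‖c‖ * rnorm x := by
  have := rnorm_lr_le (c • (1 : Matrix ι ι ℂ)) x (1 : Matrix κ κ ℂ)
  rw [lr_smul_left, lr_one_one, opNorm_smul] at this
  refine this.trans ?_
  have hx := rnorm_nonneg x
  have h1 := opNorm_nonneg (1 : Matrix ι ι ℂ)
  have h2 := opNorm_nonneg (1 : Matrix κ κ ℂ)
  calc _ ≤ ‖c‖ * 1 * rnorm x * 1 := by gcongr <;> exact opNorm_one_le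
    _ = _ := by ring

theorem rnorm_neg (x : Matrix ι κ E) : rnorm (-x) = rnorm x := by
  have h : ∀ y : Matrix ι κ E, rnorm (-y) ≤ rnorm y := fun y => by
    simpa using rnorm_smul_le (-1) y
  exact le_antisymm (h x) (by simpa using h (-x))

theorem rnorm_fromBlocks_le (x : Matrix ι κ E) (y : Matrix ι' κ' E) :
    rnorm (Matrix.fromBlocks x 0 0 y) ≤ max (rnorm x) (rnorm y) := by
  have h : Matrix.fromBlocks x 0 0 y = (dsum (pad x) (pad y)).submatrix
      (fun i => finSumFinEquiv (Sum.map (fun i => Fintype.equivFin (ι ⊕ κ) (Sum.inl i))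
        (fun i => Fintype.equivFin (ι' ⊕ κ') (Sum.inl i)) i))
      (fun i => finSumFinEquiv (Sum.map (fun i => Fintype.equivFin (ι ⊕ κ) (Sum.inr i))
        (fun i => Fintype.equivFin (ι' ⊕ κ') (Sum.inr i)) i)) := by
    ext i j
    rcases i with i | i <;> rcases j with j | j <;>
      simp [-finSumFinEquiv_apply_left, -finSumFinEquiv_apply_right, dsum, pad]
  rw [h]
  refine (rnorm_submatrix_le _ ?_ ?_).trans ?_
  · exact finSumFinEquiv.injective.comp (Function.Injective.sumMap injL injL)
  · exact finSumFinEquiv.injective.comp (Function.Injective.sumMap injR injR)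
  · rw [rnorm_eq_mnorm, mnorm_dsum]
    rfl

theorem rnorm_fromCols_le (s t : ℝ) {x : Matrix ι κ E}
    {y : Matrix ι κ' E} (hx : rnorm x ≤ 1) (hy : rnorm y ≤ 1) :
    rnorm (Matrix.fromCols ((s : ℂ) • x) ((t : ℂ) • y)) ≤ √(s ^ 2 + t ^ 2) := by
  have h : Matrix.fromCols ((s : ℂ) • x) ((t : ℂ) • y)
      = lr (Matrix.fromCols ((s : ℂ) • (1 : Matrix ι ι ℂ)) ((t : ℂ) • (1 : Matrix ι ι ℂ)))
        (Matrix.fromBlocks x 0 0 y) 1 := by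
    ext i j
    rcases j with j | j <;>
      simp [lr_apply, Matrix.one_apply, ite_smul]
  rw [h]
  have h1 : opNorm (Matrix.fromCols ((s : ℂ) • (1 : Matrix ι ι ℂ)) ((t : ℂ) • (1 : Matrix ι ι ℂ)))
      ≤ √(s ^ 2 + t ^ 2) := by
    apply opNorm_le_of_mul_conjTranspose (Real.sqrt_nonneg _)
    rw [Matrix.conjTranspose_fromCols_eq_fromRows_conjTranspose, Matrix.fromCols_mul_fromRows,
      Real.sq_sqrt (by positivity)]
    have : (s : ℂ) • (1 : Matrix ι ι ℂ) * ((s : ℂ) • (1 : Matrix ι ι ℂ)).conjTranspose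
        + (t : ℂ) • (1 : Matrix ι ι ℂ) * ((t : ℂ) • (1 : Matrix ι ι ℂ)).conjTranspose
        = ((s ^ 2 + t ^ 2 : ℝ) : ℂ) • (1 : Matrix ι ι ℂ) := by
      rw [Complex.ofReal_add, add_smul]
      simp [Matrix.conjTranspose_smul, smul_smul, sq]
      rw [← Complex.coe_smul, ← Complex.coe_smul]
      push_cast
      rfl
    rw [this, opNorm_smul, Complex.norm_real, Real.norm_of_nonneg (by positivity)]
    exact mul_le_of_le_one_right (by positivity) opNorm_one_le
  refine (rnorm_lr_le _ _ _).trans ?_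
  have h3 : rnorm (Matrix.fromBlocks x 0 0 y) ≤ 1 :=
    (rnorm_fromBlocks_le x y).trans (max_le hx hy)
  have h4 := rnorm_nonneg (Matrix.fromBlocks x 0 0 y)
  have h5 := opNorm_nonneg (1 : Matrix (κ ⊕ κ') (κ ⊕ κ') ℂ)
  calc _ ≤ √(s ^ 2 + t ^ 2) * 1 * 1 := by gcongr; exact opNorm_one_le
    _ = _ := by ring

theorem rnorm_fromRows_le (s t : ℝ) {x : Matrix ι κ E}
    {y : Matrix ι' κ E} (hx : rnorm x ≤ 1) (hy : rnorm y ≤ 1) :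
    rnorm (Matrix.fromRows ((s : ℂ) • x) ((t : ℂ) • y)) ≤ √(s ^ 2 + t ^ 2) := by
  have h : Matrix.fromRows ((s : ℂ) • x) ((t : ℂ) • y)
      = lr 1 (Matrix.fromBlocks x 0 0 y)
        (Matrix.fromRows ((s : ℂ) • (1 : Matrix κ κ ℂ)) ((t : ℂ) • (1 : Matrix κ κ ℂ))) := by
    ext i j
    rcases i with j | j <;>
      simp [lr_apply, Matrix.one_apply, ite_smul]
  rw [h]
  have h1 : opNorm (Matrix.fromRows ((s : ℂ) • (1 : Matrix κ κ ℂ)) ((t : ℂ) • (1 : Matrix κ κ ℂ)))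
      ≤ √(s ^ 2 + t ^ 2) := by
    apply opNorm_le_of_conjTranspose_mul (Real.sqrt_nonneg _)
    rw [Matrix.conjTranspose_fromRows_eq_fromCols_conjTranspose, Matrix.fromCols_mul_fromRows,
      Real.sq_sqrt (by positivity)]
    have : ((s : ℂ) • (1 : Matrix κ κ ℂ)).conjTranspose * (s : ℂ) • (1 : Matrix κ κ ℂ)
        + ((t : ℂ) • (1 : Matrix κ κ ℂ)).conjTranspose * (t : ℂ) • (1 : Matrix κ κ ℂ)
        = ((s ^ 2 + t ^ 2 : ℝ) : ℂ) • (1 : Matrix κ κ ℂ) := by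
      rw [Complex.ofReal_add, add_smul]
      simp [Matrix.conjTranspose_smul, smul_smul, sq]
      rw [← Complex.coe_smul, ← Complex.coe_smul]
      push_cast
      rfl
    rw [this, opNorm_smul, Complex.norm_real, Real.norm_of_nonneg (by positivity)]
    exact mul_le_of_le_one_right (by positivity) opNorm_one_le
  refine (rnorm_lr_le _ _ _).trans ?_
  have h3 : rnorm (Matrix.fromBlocks x 0 0 y) ≤ 1 :=
    (rnorm_fromBlocks_le x y).trans (max_le hx hy)
  have h4 := rnorm_nonneg (Matrix.fromBlocks x 0 0 y)
  have h5 := opNorm_nonneg (1 : Matrix (ι ⊕ ι') (ι ⊕ ι') ℂ)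
  calc _ ≤ 1 * 1 * √(s ^ 2 + t ^ 2) := by
        gcongr
        · exact opNorm_nonneg _
        · exact opNorm_one_le
    _ = _ := by ring

theorem norm_entry_le (x : Matrix ι κ E) (i : ι) (j : κ) : ‖x i j‖ ≤ rnorm x := by
  have h := rnorm_submatrix_le x (f := fun _ : Fin 1 => i) (g := fun _ : Fin 1 => j)
    (Function.injective_of_subsingleton _) (Function.injective_of_subsingleton _)
  rw [rnorm_eq_mnorm, mnorm_one] at h
  exact h

theorem rnorm_single_le (i : ι) (j : κ) (v : E) : rnorm (Matrix.single i j v) ≤ ‖v‖ := by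
  have h : Matrix.single i j v = lr (sel fun _ : Fin 1 => i).conjTranspose
      (Matrix.of fun _ _ => v : Matrix (Fin 1) (Fin 1) E) (sel fun _ : Fin 1 => j) := by
    ext a b
    simp [lr_apply, sel_apply, Matrix.single_apply, Matrix.conjTranspose_apply, ite_and]
    split_ifs <;> simp
  rw [h]
  refine (rnorm_lr_le_of_le_one _ (opNorm_selT_le (Function.injective_of_subsingleton _))
    (opNorm_sel_le (Function.injective_of_subsingleton _))).trans ?_
  rw [rnorm_eq_mnorm, mnorm_one]
  rfl

theorem rnorm_sum_le {τ : Type*} (s : Finset τ) (x : τ → Matrix ι κ E) :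
    rnorm (∑ t ∈ s, x t) ≤ ∑ t ∈ s, rnorm (x t) := by
  classical
  induction s using Finset.induction_on with
  | empty => simp [rnorm_zero]
  | insert a s ha ih =>
    rw [Finset.sum_insert ha, Finset.sum_insert ha]
    exact (rnorm_add_le _ _).trans (by linarith)

theorem rnorm_le_sum (x : Matrix ι κ E) : rnorm x ≤ ∑ i, ∑ j, ‖x i j‖ := by
  conv_lhs => rw [Matrix.matrix_eq_sum_single x]
  exact (rnorm_sum_le _ _).trans (Finset.sum_le_sum fun i _ => (rnorm_sum_le _ _).trans
    (Finset.sum_le_sum fun j _ => rnorm_single_le i j _))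

theorem abs_rnorm_sub_le (x y : Matrix ι κ E) : |rnorm x - rnorm y| ≤ rnorm (x - y) := by
  rw [abs_sub_le_iff]
  constructor
  · have := rnorm_add_le (x - y) y
    rw [sub_add_cancel] at this
    linarith
  · have := rnorm_add_le (-(x - y)) x
    rw [rnorm_neg] at this
    have h : -(x - y) + x = y := by abel
    rw [h] at this
    linarith

theorem uniformContinuous_rnorm : UniformContinuous (rnorm : Matrix ι κ E → ℝ) := by
  have h : LipschitzWith (Fintype.card ι * Fintype.card κ : ℕ)
      (fun x : ι → κ → E => rnorm (Matrix.of x)) := by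
    refine LipschitzWith.of_dist_le_mul fun x y => ?_
    rw [Real.dist_eq]
    refine (abs_rnorm_sub_le _ _).trans ((rnorm_le_sum _).trans ?_)
    calc _ ≤ ∑ _i : ι, ∑ _j : κ, dist x y := by
          refine Finset.sum_le_sum fun i _ => Finset.sum_le_sum fun j _ => ?_
          have h1 := dist_le_pi_dist (x i) (y i) j
          have h2 := dist_le_pi_dist x y i
          rw [dist_eq_norm (x i j)] at h1
          exact h1.trans h2
      _ = _ := by simp [mul_assoc]
  exact h.uniformContinuous

theorem continuous_rnorm : Continuous (rnorm : Matrix ι κ E → ℝ) :=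
  uniformContinuous_rnorm.continuous

end Ruan

open MatrixNormed

section Haagerup

variable {E F : Type*} [SeminormedAddCommGroup E] [NormedSpace ℂ E]
  [SeminormedAddCommGroup F] [NormedSpace ℂ F]

/-- The matrix product `x ⊙ y` over the tensor product: `(x ⊙ y) i j = ∑ k, x i k ⊗ y k j`. -/
noncomputable def odot {E F : Type*} [AddCommGroup E] [Module ℂ E] [AddCommGroup F] [Module ℂ F]
    {ι κ ι' : Type} [Fintype κ] (x : Matrix ι κ E) (y : Matrix κ ι' F) :
    Matrix ι ι' (E ⊗[ℂ] F) :=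
  Matrix.of fun i j => ∑ k, x i k ⊗ₜ[ℂ] y k j

/-- The Haagerup matrix (semi)norms on the algebraic tensor product:
`‖u‖ₙ = inf {‖x‖ ‖y‖ : u = x ⊙ y, x ∈ M_{n,p}(E), y ∈ M_{p,n}(F), p ∈ ℕ}`. -/
noncomputable def hnorm [MatrixNormed E] [MatrixNormed F] {n : ℕ}
    (u : Matrix (Fin n) (Fin n) (E ⊗[ℂ] F)) : ℝ :=
  sInf {r : ℝ | ∃ (p : ℕ) (x : Matrix (Fin n) (Fin p) E) (y : Matrix (Fin p) (Fin n) F),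
    u = odot x y ∧ r = rnorm x * rnorm y}

variable {ι ι' ι'' κ κ' κ'' : Type} [Fintype ι] [Fintype ι'] [Fintype ι''] [Fintype κ] [Fintype κ']
  [Fintype κ''] [DecidableEq ι] [DecidableEq ι'] [DecidableEq ι''] [DecidableEq κ] [DecidableEq κ']
  [DecidableEq κ'']

theorem odot_apply {E F : Type*} [AddCommGroup E] [Module ℂ E] [AddCommGroup F] [Module ℂ F]
    {ι κ ι' : Type} [Fintype κ] (x : Matrix ι κ E) (y : Matrix κ ι' F) (i : ι) (j : ι') :
    odot x y i j = ∑ k, x i k ⊗ₜ[ℂ] y k j := rfl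

theorem lr_odot (α : Matrix ι' ι ℂ) (x : Matrix ι κ E) (y : Matrix κ κ' F) (β : Matrix κ' κ'' ℂ) :
    lr α (odot x y) β = odot (lr α x (1 : Matrix κ κ ℂ)) (lr (1 : Matrix κ κ ℂ) y β) := by
  ext i j
  simp only [odot_apply, lr_one_right, lr_one_left]
  simp only [lr_apply, odot_apply, TensorProduct.sum_tmul, TensorProduct.tmul_sum,
    TensorProduct.smul_tmul_smul, Finset.smul_sum]
  have h : ∀ a : ι, (∑ l : κ', ∑ k : κ, (α i a * β l j) • x a k ⊗ₜ[ℂ] y k l)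
      = ∑ k : κ, ∑ l : κ', (α i a * β l j) • x a k ⊗ₜ[ℂ] y k l := fun a => Finset.sum_comm
  simp only [h]
  rw [Finset.sum_comm]
  exact Finset.sum_congr rfl fun k _ => Finset.sum_comm

theorem odot_smul_smul (c d : ℂ) (x : Matrix ι κ E) (y : Matrix κ ι' F) :
    odot (c • x) (d • y) = (c * d) • odot x y := by
  ext i j
  simp only [odot_apply, Matrix.smul_apply, Finset.smul_sum, TensorProduct.smul_tmul_smul]

theorem odot_fromCols_fromRows (x : Matrix ι κ E) (x' : Matrix ι κ' E) (y : Matrix κ ι' F)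
    (y' : Matrix κ' ι' F) :
    odot (Matrix.fromCols x x') (Matrix.fromRows y y') = odot x y + odot x' y' := by
  ext i j
  simp [odot_apply]

theorem odot_fromBlocks (x : Matrix ι κ E) (x' : Matrix ι' κ' E) (y : Matrix κ ι F)
    (y' : Matrix κ' ι' F) :
    odot (Matrix.fromBlocks x 0 0 x') (Matrix.fromBlocks y 0 0 y') =
      Matrix.fromBlocks (odot x y) 0 0 (odot x' y') := by
  ext i j
  rcases i with i | i <;> rcases j with j | j <;> simp [odot_apply]

theorem odot_submatrix {ι κ ι' κ' ι'' κ'' : Type} [Fintype κ] [Fintype κ'] (x : Matrix ι κ E)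
    (y : Matrix κ ι' F) (f : ι'' → ι) (g : κ'' → ι') (e : κ' ≃ κ) : odot (x.submatrix f e) (y.submatrix e g) = (odot x y).submatrix f g := by
  ext i j
  simp only [odot_apply, Matrix.submatrix_apply]
  exact e.sum_comp fun k => x (f i) k ⊗ₜ[ℂ] y k (g j)

theorem exists_odot_of_finite (u : Matrix ι ι' (E ⊗[ℂ] F)) :
    ∃ (p : ℕ) (x : Matrix ι (Fin p) E) (y : Matrix (Fin p) ι' F), u = odot x y := by
  have add : ∀ u v : Matrix ι ι' (E ⊗[ℂ] F),
      (∃ (p : ℕ) (x : Matrix ι (Fin p) E) (y : Matrix (Fin p) ι' F), u = odot x y) →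
      (∃ (p : ℕ) (x : Matrix ι (Fin p) E) (y : Matrix (Fin p) ι' F), v = odot x y) →
      (∃ (p : ℕ) (x : Matrix ι (Fin p) E) (y : Matrix (Fin p) ι' F), u + v = odot x y) := by
    rintro _ _ ⟨p, x, y, rfl⟩ ⟨q, x', y', rfl⟩
    refine ⟨p + q, (Matrix.fromCols x x').submatrix id finSumFinEquiv.symm,
      (Matrix.fromRows y y').submatrix finSumFinEquiv.symm id, ?_⟩
    rw [odot_submatrix, odot_fromCols_fromRows, Matrix.submatrix_id_id]
  have zero : ∃ (p : ℕ) (x : Matrix ι (Fin p) E) (y : Matrix (Fin p) ι' F),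
      (0 : Matrix ι ι' (E ⊗[ℂ] F)) = odot x y :=
    ⟨0, 0, 0, by ext i j; simp [odot_apply]⟩
  induction u using Matrix.induction_on' with
  | h_zero => exact zero
  | h_add p q hp hq => exact add p q hp hq
  | h_std_basis i j v =>
    induction v using TensorProduct.induction_on with
    | zero => simpa using zero
    | add a b ha hb => rw [Matrix.single_add]; exact add _ _ ha hb
    | tmul a b =>
      refine ⟨1, Matrix.single i 0 a, Matrix.single 0 j b, ?_⟩
      ext k l
      simp only [odot_apply, Matrix.single_apply, Finset.univ_unique, Finset.sum_singleton,
        Fin.default_eq_zero, and_true, true_and]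
      by_cases h1 : i = k <;> by_cases h2 : j = l <;> simp [h1, h2]

variable [MatrixNormed E] [MatrixNormed F]

theorem hnorm_bddBelow {n : ℕ} (u : Matrix (Fin n) (Fin n) (E ⊗[ℂ] F)) :
    BddBelow {r : ℝ | ∃ (p : ℕ) (x : Matrix (Fin n) (Fin p) E) (y : Matrix (Fin p) (Fin n) F),
      u = odot x y ∧ r = rnorm x * rnorm y} := by
  refine ⟨0, ?_⟩
  rintro _ ⟨p, x, y, -, rfl⟩
  exact mul_nonneg (rnorm_nonneg _) (rnorm_nonneg _)

theorem hnorm_nonempty {n : ℕ} (u : Matrix (Fin n) (Fin n) (E ⊗[ℂ] F)) :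
    {r : ℝ | ∃ (p : ℕ) (x : Matrix (Fin n) (Fin p) E) (y : Matrix (Fin p) (Fin n) F),
      u = odot x y ∧ r = rnorm x * rnorm y}.Nonempty := by
  obtain ⟨p, x, y, h⟩ := exists_odot_of_finite u
  exact ⟨_, p, x, y, h, rfl⟩

theorem hnorm_nonneg {n : ℕ} (u : Matrix (Fin n) (Fin n) (E ⊗[ℂ] F)) : 0 ≤ hnorm u := by
  refine Real.sInf_nonneg ?_
  rintro _ ⟨p, x, y, -, rfl⟩
  exact mul_nonneg (rnorm_nonneg _) (rnorm_nonneg _)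

theorem hnorm_odot_le {n : ℕ} (x : Matrix (Fin n) κ E) (y : Matrix κ (Fin n) F) :
    hnorm (odot x y) ≤ rnorm x * rnorm y := by
  have e := Fintype.equivFin κ
  rw [← rnorm_submatrix_equiv x (Equiv.refl _) e.symm,
    ← rnorm_submatrix_equiv y e.symm (Equiv.refl _)]
  refine csInf_le (hnorm_bddBelow _) ⟨_, x.submatrix id e.symm, y.submatrix e.symm id, ?_, rfl⟩
  rw [odot_submatrix, Matrix.submatrix_id_id]

theorem exists_factor {n : ℕ} {u : Matrix (Fin n) (Fin n) (E ⊗[ℂ] F)} {s : ℝ} (hs : 0 < s)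
    (h : hnorm u < s ^ 2) : ∃ (p : ℕ) (x : Matrix (Fin n) (Fin p) E) (y : Matrix (Fin p) (Fin n) F),
      u = odot ((s : ℂ) • x) ((s : ℂ) • y) ∧ rnorm x ≤ 1 ∧ rnorm y ≤ 1 := by
  obtain ⟨_, ⟨p, x, y, rfl, rfl⟩, hr⟩ := exists_lt_of_csInf_lt (hnorm_nonempty u) h
  have ha := rnorm_nonneg x
  have hb := rnorm_nonneg y
  obtain ⟨c, hc, h1, h2⟩ : ∃ c : ℝ, 0 < c ∧ c * rnorm x ≤ s ∧ c⁻¹ * rnorm y ≤ s := by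
    rcases ha.eq_or_lt with h0 | h0
    · refine ⟨(rnorm y + 1) / s, by positivity, by rw [← h0]; simpa using hs.le, ?_⟩
      rw [inv_div, div_mul_eq_mul_div, div_le_iff₀ (by positivity)]
      nlinarith
    · refine ⟨s / rnorm x, by positivity, by field_simp; rfl, ?_⟩
      rw [inv_div, div_mul_eq_mul_div, div_le_iff₀ hs]
      nlinarith
  refine ⟨p, ((s⁻¹ * c : ℝ) : ℂ) • x, ((s⁻¹ * c⁻¹ : ℝ) : ℂ) • y, ?_, ?_, ?_⟩
  · rw [smul_smul, smul_smul, odot_smul_smul]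
    have : (s : ℂ) * ((s⁻¹ * c : ℝ) : ℂ) * ((s : ℂ) * ((s⁻¹ * c⁻¹ : ℝ) : ℂ)) = 1 := by
      have h1 : (s : ℂ) ≠ 0 := by exact_mod_cast hs.ne'
      have h2 : (c : ℂ) ≠ 0 := by exact_mod_cast hc.ne'
      push_cast
      field_simp
    rw [this, one_smul]
  · refine (rnorm_smul_le _ _).trans ?_
    rw [Complex.norm_real, Real.norm_of_nonneg (by positivity), mul_assoc, inv_mul_le_iff₀ hs,
      mul_one]
    exact h1
  · refine (rnorm_smul_le _ _).trans ?_
    rw [Complex.norm_real, Real.norm_of_nonneg (by positivity), mul_assoc, inv_mul_le_iff₀ hs,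
      mul_one]
    exact h2

theorem hnorm_add_le {n : ℕ} (u v : Matrix (Fin n) (Fin n) (E ⊗[ℂ] F)) :
    hnorm (u + v) ≤ hnorm u + hnorm v := by
  refine le_of_forall_pos_le_add fun ε hε => ?_
  have hu := hnorm_nonneg u
  have hv := hnorm_nonneg v
  have e1 : √(hnorm u + ε / 2) ^ 2 = hnorm u + ε / 2 := Real.sq_sqrt (by positivity)
  have e2 : √(hnorm v + ε / 2) ^ 2 = hnorm v + ε / 2 := Real.sq_sqrt (by positivity)
  obtain ⟨p, x, y, h1, hx, hy⟩ := exists_factor (u := u) (s := √(hnorm u + ε / 2))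
    (Real.sqrt_pos.2 (by positivity)) (by rw [e1]; linarith)
  obtain ⟨q, x', y', h2, hx', hy'⟩ := exists_factor (u := v) (s := √(hnorm v + ε / 2))
    (Real.sqrt_pos.2 (by positivity)) (by rw [e2]; linarith)
  generalize √(hnorm u + ε / 2) = s at *
  generalize √(hnorm v + ε / 2) = t at *
  have h : u + v = odot (Matrix.fromCols ((s : ℂ) • x) ((t : ℂ) • x'))
      (Matrix.fromRows ((s : ℂ) • y) ((t : ℂ) • y')) := by
    rw [odot_fromCols_fromRows, ← h1, ← h2]
  calc hnorm (u + v) ≤ rnorm (Matrix.fromCols ((s : ℂ) • x) ((t : ℂ) • x')) *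
        rnorm (Matrix.fromRows ((s : ℂ) • y) ((t : ℂ) • y')) := by
        rw [h]; exact hnorm_odot_le _ _
    _ ≤ √(s ^ 2 + t ^ 2) * √(s ^ 2 + t ^ 2) :=
        mul_le_mul (rnorm_fromCols_le s t hx hx') (rnorm_fromRows_le s t hy hy') (rnorm_nonneg _)
          (Real.sqrt_nonneg _)
    _ = s ^ 2 + t ^ 2 := Real.mul_self_sqrt (by positivity)
    _ = _ := by rw [e1, e2]; ring

theorem hnorm_lr_le {m n : ℕ} (α : Matrix (Fin n) (Fin m) ℂ)
    (u : Matrix (Fin m) (Fin m) (E ⊗[ℂ] F)) (β : Matrix (Fin m) (Fin n) ℂ) :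
    hnorm (lr α u β) ≤ opNorm α * hnorm u * opNorm β := by
  have hα := opNorm_nonneg α
  have hβ := opNorm_nonneg β
  have h : opNorm α * hnorm u * opNorm β = (opNorm α * opNorm β) • hnorm u := by
    rw [smul_eq_mul]; ring
  rw [h, hnorm, hnorm, ← Real.sInf_smul_of_nonneg (by positivity)]
  refine le_csInf (Set.Nonempty.smul_set (hnorm_nonempty u)) ?_
  rintro _ ⟨_, ⟨p, x, y, rfl, rfl⟩, rfl⟩
  refine (csInf_le (hnorm_bddBelow _) ⟨p, lr α x 1, lr 1 y β, lr_odot _ _ _ _, rfl⟩).trans ?_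
  have hx := rnorm_nonneg x
  have hy := rnorm_nonneg y
  have h1 : rnorm (lr α x (1 : Matrix (Fin p) (Fin p) ℂ)) ≤ opNorm α * rnorm x :=
    (rnorm_lr_le _ _ _).trans (mul_le_of_le_one_right (by positivity) opNorm_one_le)
  have h2 : rnorm (lr (1 : Matrix (Fin p) (Fin p) ℂ) y β) ≤ rnorm y * opNorm β := by
    refine (rnorm_lr_le _ _ _).trans ?_
    rw [mul_assoc]
    exact mul_le_of_le_one_left (by positivity) opNorm_one_le
  refine (mul_le_mul h1 h2 (rnorm_nonneg _) (by positivity)).trans (le_of_eq ?_)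
  simp only [smul_eq_mul]
  ring

theorem hnorm_submatrix_le {m n : ℕ} (u : Matrix (Fin m) (Fin m) (E ⊗[ℂ] F))
    {f g : Fin n → Fin m} (hf : Function.Injective f) (hg : Function.Injective g) :
    hnorm (u.submatrix f g) ≤ hnorm u := by
  have h : u.submatrix f g = lr (sel f) u (sel g).conjTranspose := (lr_sel f g u).symm
  rw [h]
  refine (hnorm_lr_le _ _ _).trans ?_
  have hu := hnorm_nonneg u
  have h1 := opNorm_sel_le hf
  have h2 := opNorm_selT_le hg
  have h3 := opNorm_nonneg (sel f)
  calc _ ≤ 1 * hnorm u * 1 :=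
        mul_le_mul (mul_le_mul_of_nonneg_right h1 hu) h2 (opNorm_nonneg _) (by positivity)
    _ = _ := by ring

theorem hnorm_dsum {m n : ℕ} (u : Matrix (Fin m) (Fin m) (E ⊗[ℂ] F))
    (v : Matrix (Fin n) (Fin n) (E ⊗[ℂ] F)) : hnorm (dsum u v) = max (hnorm u) (hnorm v) := by
  apply le_antisymm
  · refine le_of_forall_pos_le_add fun ε hε => ?_
    have hu := hnorm_nonneg u
    have hm : 0 ≤ max (hnorm u) (hnorm v) := hu.trans (le_max_left _ _)
    have e1 : √(max (hnorm u) (hnorm v) + ε) ^ 2 = max (hnorm u) (hnorm v) + ε :=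
      Real.sq_sqrt (by positivity)
    have hs : 0 < √(max (hnorm u) (hnorm v) + ε) := Real.sqrt_pos.2 (by positivity)
    obtain ⟨p, x, y, h1, hx, hy⟩ := exists_factor (u := u) hs
      (by rw [e1]; linarith [le_max_left (hnorm u) (hnorm v)])
    obtain ⟨q, x', y', h2, hx', hy'⟩ := exists_factor (u := v) hs
      (by rw [e1]; linarith [le_max_right (hnorm u) (hnorm v)])
    rw [← e1]
    generalize √(max (hnorm u) (hnorm v) + ε) = s at *
    have h : dsum u v = odot (((s : ℂ) • Matrix.fromBlocks x 0 0 x').submatrix finSumFinEquiv.symm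
        (Equiv.refl _)) (((s : ℂ) • Matrix.fromBlocks y 0 0 y').submatrix (Equiv.refl _)
          finSumFinEquiv.symm) := by
      rw [odot_submatrix, odot_smul_smul, odot_fromBlocks, h1, h2, odot_smul_smul, odot_smul_smul,
        dsum, Matrix.fromBlocks_smul, smul_zero, smul_zero]
    rw [h]
    refine (hnorm_odot_le _ _).trans ?_
    rw [rnorm_submatrix_equiv, rnorm_submatrix_equiv, sq]
    refine mul_le_mul ?_ ?_ (rnorm_nonneg _) hs.le
    · refine (rnorm_smul_le _ _).trans ?_
      rw [Complex.norm_real, Real.norm_of_nonneg hs.le]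
      exact mul_le_of_le_one_right hs.le ((rnorm_fromBlocks_le _ _).trans (max_le hx hx'))
    · refine (rnorm_smul_le _ _).trans ?_
      rw [Complex.norm_real, Real.norm_of_nonneg hs.le]
      exact mul_le_of_le_one_right hs.le ((rnorm_fromBlocks_le _ _).trans (max_le hy hy'))
  · apply max_le
    · have h : u = (dsum u v).submatrix (fun i => finSumFinEquiv (Sum.inl i))
          (fun i => finSumFinEquiv (Sum.inl i)) := by
        ext i j; simp [-finSumFinEquiv_apply_left, dsum]
      conv_lhs => rw [h]
      exact hnorm_submatrix_le _ (finSumFinEquiv.injective.comp Sum.inl_injective)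
        (finSumFinEquiv.injective.comp Sum.inl_injective)
    · have h : v = (dsum u v).submatrix (fun i => finSumFinEquiv (Sum.inr i))
          (fun i => finSumFinEquiv (Sum.inr i)) := by
        ext i j; simp [-finSumFinEquiv_apply_right, dsum]
      conv_lhs => rw [h]
      exact hnorm_submatrix_le _ (finSumFinEquiv.injective.comp Sum.inr_injective)
        (finSumFinEquiv.injective.comp Sum.inr_injective)

theorem hnorm_smul_le {n : ℕ} (c : ℂ) (u : Matrix (Fin n) (Fin n) (E ⊗[ℂ] F)) :
    hnorm (c • u) ≤ ‖c‖ * hnorm u := by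
  have h : c • u = lr (c • (1 : Matrix (Fin n) (Fin n) ℂ)) u 1 := by
    rw [lr_smul_left, lr_one_one]
  rw [h]
  refine (hnorm_lr_le _ _ _).trans ?_
  rw [opNorm_smul]
  have hu := hnorm_nonneg u
  have h1 := opNorm_nonneg (1 : Matrix (Fin n) (Fin n) ℂ)
  calc _ ≤ ‖c‖ * 1 * hnorm u * 1 := by gcongr <;> exact opNorm_one_le
    _ = _ := by ring

theorem hnorm_smul {n : ℕ} (c : ℂ) (u : Matrix (Fin n) (Fin n) (E ⊗[ℂ] F)) :
    hnorm (c • u) = ‖c‖ * hnorm u := by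
  rcases eq_or_ne c 0 with rfl | hc
  · apply le_antisymm (hnorm_smul_le _ _)
    simpa using hnorm_nonneg _
  apply le_antisymm (hnorm_smul_le _ _)
  have h := hnorm_smul_le c⁻¹ (c • u)
  rw [smul_smul, inv_mul_cancel₀ hc, one_smul, norm_inv] at h
  have : 0 < ‖c‖ := norm_pos_iff.2 hc
  rwa [le_inv_mul_iff₀ this] at h

end Haagerup

section HTensor

/-- The algebraic tensor product `E ⊗ F`, considered with the Haagerup matrix norms. -/
def HTensor (E F : Type*) [SeminormedAddCommGroup E] [NormedSpace ℂ E]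
    [SeminormedAddCommGroup F] [NormedSpace ℂ F] : Type _ := E ⊗[ℂ] F

variable (E F : Type*) [SeminormedAddCommGroup E] [NormedSpace ℂ E]
  [SeminormedAddCommGroup F] [NormedSpace ℂ F] [MatrixNormed E] [MatrixNormed F]

noncomputable instance : AddCommGroup (HTensor E F) := inferInstanceAs (AddCommGroup (E ⊗[ℂ] F))

noncomputable instance : Module ℂ (HTensor E F) := inferInstanceAs (Module ℂ (E ⊗[ℂ] F))

noncomputable instance : Norm (HTensor E F) where
  norm u := hnorm (Matrix.of fun _ _ : Fin 1 => (u : E ⊗[ℂ] F))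

theorem HTensor.core : SeminormedSpace.Core ℂ (HTensor E F) where
  norm_nonneg _ := hnorm_nonneg (E := E) (F := F) _
  norm_smul c _ := hnorm_smul (E := E) (F := F) c _
  norm_triangle _ _ := hnorm_add_le (E := E) (F := F) _ _

noncomputable instance : SeminormedAddCommGroup (HTensor E F) :=
  SeminormedAddCommGroup.ofCore (HTensor.core E F)

noncomputable instance : NormedSpace ℂ (HTensor E F) where
  norm_smul_le c _ := (hnorm_smul (E := E) (F := F) c _).le

noncomputable instance : MatrixNormed (HTensor E F) where
  mnorm u := hnorm (E := E) (F := F) u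
  mnorm_one x := by
    change hnorm (E := E) (F := F) x = hnorm (E := E) (F := F) (Matrix.of fun _ _ => x 0 0)
    congr 1
    ext i j
    rw [Subsingleton.elim i 0, Subsingleton.elim j 0]
    rfl
  mnorm_add_le x y := hnorm_add_le (E := E) (F := F) x y
  mnorm_lr_le α x β := hnorm_lr_le (E := E) (F := F) α x β
  mnorm_dsum x y := hnorm_dsum (E := E) (F := F) x y

variable {E F}

/-- `x ⊙ y` as a matrix over `E ⊗ F` with the Haagerup matrix norms. -/
noncomputable def hodot {ι κ ι' : Type} [Fintype κ] (x : Matrix ι κ E) (y : Matrix κ ι' F) :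
    Matrix ι ι' (HTensor E F) := odot x y

theorem mnorm_hodot_le {n : ℕ} {κ : Type} [Fintype κ] [DecidableEq κ] (x : Matrix (Fin n) κ E)
    (y : Matrix κ (Fin n) F) : mnorm (hodot x y) ≤ rnorm x * rnorm y :=
  hnorm_odot_le x y

theorem exists_hfactor {n : ℕ} {u : Matrix (Fin n) (Fin n) (HTensor E F)} {s : ℝ} (hs : 0 < s)
    (h : mnorm u < s ^ 2) : ∃ (p : ℕ) (x : Matrix (Fin n) (Fin p) E) (y : Matrix (Fin p) (Fin n) F),
      u = hodot ((s : ℂ) • x) ((s : ℂ) • y) ∧ rnorm x ≤ 1 ∧ rnorm y ≤ 1 :=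
  exists_factor (E := E) (F := F) hs h

theorem hodot_submatrix {ι κ ι' κ' ι'' κ'' : Type} [Fintype κ] [Fintype κ'] (x : Matrix ι κ E)
    (y : Matrix κ ι' F) (f : ι'' → ι) (g : κ'' → ι') (e : κ' ≃ κ) :
    hodot (x.submatrix f e) (y.submatrix e g) = (hodot x y).submatrix f g :=
  odot_submatrix x y f g e

end HTensor

section Completion

open UniformSpace

variable {V : Type*} [SeminormedAddCommGroup V] [NormedSpace ℂ V]
variable {ι κ : Type} [Fintype ι] [Fintype κ] [DecidableEq ι] [DecidableEq κ]

/-- The entrywise inclusion of matrices over `V` into matrices over the completion of `V`. -/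
def cmap {ι κ : Type} {V : Type*} [SeminormedAddCommGroup V] (x : Matrix ι κ V) :
    Matrix ι κ (Completion V) :=
  x.map fun v => (v : Completion V)

theorem cmap_isUniformInducing : IsUniformInducing (cmap : Matrix ι κ V → _) := by
  constructor
  rw [Matrix.uniformity, Matrix.uniformity, Filter.comap_iInf]
  refine iInf_congr fun i => ?_
  rw [Filter.comap_iInf]
  refine iInf_congr fun j => ?_
  rw [Filter.comap_comap, ← (Completion.isUniformInducing_coe V).comap_uniformity,
    Filter.comap_comap]
  rfl

theorem cmap_denseRange : DenseRange (cmap : Matrix ι κ V → _) := by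
  have h : DenseRange (Pi.map fun _ : ι => Pi.map fun _ : κ => ((↑) : V → Completion V)) :=
    DenseRange.piMap fun _ => DenseRange.piMap fun _ => Completion.denseRange_coe
  exact h

theorem cmap_isDenseInducing : IsDenseInducing (cmap : Matrix ι κ V → _) :=
  cmap_isUniformInducing.isDenseInducing cmap_denseRange

theorem cmap_add (x y : Matrix ι κ V) : cmap (x + y) = cmap x + cmap y := by
  ext i j
  exact UniformSpace.Completion.coe_add _ _

theorem cmap_lr {ι' κ' : Type} [Fintype κ'] [Fintype ι'] [DecidableEq κ'] [DecidableEq ι'] (α : Matrix ι' ι ℂ) (x : Matrix ι κ V) (β : Matrix κ κ' ℂ) :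
    cmap (lr α x β) = lr α (cmap x) β :=
  lr_map (Completion.toComplL (𝕜 := ℂ) (E := V) : V →ₗ[ℂ] Completion V) α x β

theorem cmap_dsum {m n : ℕ} (x : Matrix (Fin m) (Fin m) V) (y : Matrix (Fin n) (Fin n) V) :
    cmap (dsum x y) = dsum (cmap x) (cmap y) := by
  ext i j
  obtain ⟨i, rfl⟩ := finSumFinEquiv.surjective i
  obtain ⟨j, rfl⟩ := finSumFinEquiv.surjective j
  rcases i with i | i <;> rcases j with j | j <;>
    simp [cmap, dsum, -finSumFinEquiv_apply_left, -finSumFinEquiv_apply_right] <;> rfl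

theorem continuous_lr {ι' κ' : Type} [Fintype κ'] [Fintype ι'] [DecidableEq κ'] [DecidableEq ι']
    (α : Matrix ι' ι ℂ) (β : Matrix κ κ' ℂ) :
    Continuous fun x : Matrix ι κ V => lr α x β := by
  refine continuous_matrix fun i j => ?_
  simp only [lr_apply]
  fun_prop

theorem continuous_dsum {m n : ℕ} :
    Continuous fun p : Matrix (Fin m) (Fin m) V × Matrix (Fin n) (Fin n) V => dsum p.1 p.2 :=
  Continuous.matrix_submatrix (Continuous.matrix_fromBlocks continuous_fst continuous_const
    continuous_const continuous_snd) _ _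

variable [MatrixNormed V]

theorem uniformContinuous_mnorm {n : ℕ} :
    UniformContinuous (mnorm : Matrix (Fin n) (Fin n) V → ℝ) := by
  have h : (mnorm : Matrix (Fin n) (Fin n) V → ℝ) = rnorm := by
    funext x
    exact (rnorm_eq_mnorm x).symm
  rw [h]
  exact uniformContinuous_rnorm

/-- The continuous extension of `‖·‖ₙ` from `M_n(V)` to `M_n` of the completion of `V`. -/
noncomputable def cnorm {n : ℕ} (ξ : Matrix (Fin n) (Fin n) (Completion V)) : ℝ :=
  (cmap_isDenseInducing (V := V)).extend mnorm ξ

theorem continuous_cnorm {n : ℕ} :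
    Continuous (cnorm : Matrix (Fin n) (Fin n) (Completion V) → ℝ) :=
  (uniformContinuous_uniformly_extend cmap_isUniformInducing cmap_denseRange
    uniformContinuous_mnorm).continuous

theorem cnorm_cmap {n : ℕ} (x : Matrix (Fin n) (Fin n) V) : cnorm (cmap x) = mnorm x :=
  IsDenseInducing.extend_eq _ uniformContinuous_mnorm.continuous x

noncomputable instance : MatrixNormed (Completion V) where
  mnorm ξ := cnorm ξ
  mnorm_one ξ := by
    refine cmap_denseRange.induction_on (p := fun ξ => cnorm ξ = ‖ξ 0 0‖) ξ
      (isClosed_eq continuous_cnorm (by fun_prop)) fun x => ?_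
    rw [cnorm_cmap, mnorm_one, cmap, Matrix.map_apply, Completion.norm_coe]
  mnorm_add_le ξ η := by
    refine cmap_denseRange.induction_on₂ (p := fun ξ η => cnorm (ξ + η) ≤ cnorm ξ + cnorm η)
      (isClosed_le (continuous_cnorm.comp continuous_add)
        ((continuous_cnorm.comp continuous_fst).add (continuous_cnorm.comp continuous_snd)))
      (fun x y => ?_) ξ η
    rw [← cmap_add, cnorm_cmap, cnorm_cmap, cnorm_cmap]
    exact mnorm_add_le x y
  mnorm_lr_le α ξ β := by
    refine cmap_denseRange.induction_on
      (p := fun ξ => cnorm (lr α ξ β) ≤ opNorm α * cnorm ξ * opNorm β) ξ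
      (isClosed_le (continuous_cnorm.comp (continuous_lr α β))
        ((continuous_const.mul continuous_cnorm).mul continuous_const)) fun x => ?_
    rw [← cmap_lr, cnorm_cmap, cnorm_cmap]
    exact mnorm_lr_le α x β
  mnorm_dsum {m n} ξ η := by
    have h : ∀ p : Matrix (Fin m) (Fin m) (Completion V) × Matrix (Fin n) (Fin n) (Completion V),
        cnorm (dsum p.1 p.2) = max (cnorm p.1) (cnorm p.2) := by
      intro p
      refine (cmap_denseRange.prodMap cmap_denseRange).induction_on
        (p := fun p => cnorm (dsum p.1 p.2) = max (cnorm p.1) (cnorm p.2)) p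
        (isClosed_eq (continuous_cnorm.comp continuous_dsum)
          ((continuous_cnorm.comp continuous_fst).max (continuous_cnorm.comp continuous_snd)))
        fun q => ?_
      simp only [Prod.map_fst, Prod.map_snd]
      rw [← cmap_dsum, cnorm_cmap, cnorm_cmap, cnorm_cmap]
      exact mnorm_dsum q.1 q.2
    exact h (ξ, η)

theorem mnorm_cmap {n : ℕ} (x : Matrix (Fin n) (Fin n) V) : mnorm (cmap x) = mnorm x :=
  cnorm_cmap x

theorem rnorm_cmap (x : Matrix ι κ V) : rnorm (cmap x) = rnorm x := by
  unfold rnorm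
  rw [pad_eq_lr, ← cmap_lr, ← pad_eq_lr, mnorm_cmap]

end Completion

section Algebras

open MulOpposite

/-- A unital operator algebra: a unital Banach algebra `A` that is also an operator space, with
`‖1‖ ≤ 1`, such that the map `A ⊗ A → A` given by the multiplication is completely contractive
for the Haagerup matrix norms. -/
class OperatorAlgebra (A : Type*) [NormedRing A] [NormedAlgebra ℂ A] [MatrixNormed A] : Prop where
  norm_one_le : ‖(1 : A)‖ ≤ 1
  mnorm_mul_le : ∀ {n : ℕ} (u : Matrix (Fin n) (Fin n) (A ⊗[ℂ] A)),
    mnorm (u.map (LinearMap.mul' ℂ A)) ≤ hnorm u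

/-- The linear map `E ⊗ A → E`, `x ⊗ a ↦ x · a`, given by the action on a right `A`-module. -/
noncomputable def actionMap (A E : Type*) [Ring A] [Algebra ℂ A] [AddCommGroup E] [Module ℂ E]
    [Module Aᵐᵒᵖ E] [IsScalarTower ℂ Aᵐᵒᵖ E] : E ⊗[ℂ] A →ₗ[ℂ] E :=
  TensorProduct.lift (LinearMap.mk₂ ℂ (fun (x : E) (a : A) => op a • x)
    (fun x y a => smul_add _ _ _)
    (fun c x a => by
      rw [← algebraMap_smul Aᵐᵒᵖ c x, ← algebraMap_smul Aᵐᵒᵖ c (op a • x), smul_smul, smul_smul,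
        Algebra.commutes])
    (fun x a b => by rw [op_add, add_smul])
    (fun c x a => by rw [op_smul, smul_assoc]))

/-- A right `A`-module `E` that is an operator space is a right operator `A`-module if the map
`E ⊗ A → E` given by the module action is completely contractive for the Haagerup matrix
norms. -/
class OperatorModule (A E : Type*) [NormedRing A] [NormedAlgebra ℂ A] [MatrixNormed A]
    [SeminormedAddCommGroup E] [NormedSpace ℂ E] [MatrixNormed E]
    [Module Aᵐᵒᵖ E] [IsScalarTower ℂ Aᵐᵒᵖ E] : Prop where
  mnorm_action_le : ∀ {n : ℕ} (u : Matrix (Fin n) (Fin n) (E ⊗[ℂ] A)),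
    mnorm (u.map (actionMap A E)) ≤ hnorm u

variable {ι ι' κ κ' : Type} [Fintype ι] [Fintype ι'] [Fintype κ] [Fintype κ']
  [DecidableEq ι] [DecidableEq ι'] [DecidableEq κ] [DecidableEq κ']

theorem rnorm_map_odot_le {E F G : Type*} [SeminormedAddCommGroup E] [NormedSpace ℂ E]
    [SeminormedAddCommGroup F] [NormedSpace ℂ F] [SeminormedAddCommGroup G] [NormedSpace ℂ G]
    [MatrixNormed E] [MatrixNormed F] [MatrixNormed G] (f : E ⊗[ℂ] F →ₗ[ℂ] G)
    (hf : ∀ {n : ℕ} (u : Matrix (Fin n) (Fin n) (E ⊗[ℂ] F)), mnorm (u.map f) ≤ hnorm u)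
    (x : Matrix ι κ E) (y : Matrix κ ι' F) :
    rnorm ((odot x y).map f) ≤ rnorm x * rnorm y := by
  unfold rnorm
  rw [pad_eq_lr, ← lr_map, lr_odot]
  refine (hf _).trans ((hnorm_odot_le _ _).trans ?_)
  exact mul_le_mul (rnorm_lr_le_of_le_one _ (opNorm_selT_le injL) opNorm_one_le)
    (rnorm_lr_le_of_le_one _ opNorm_one_le (opNorm_sel_le injR)) (rnorm_nonneg _) (rnorm_nonneg _)

variable {E A : Type*} [SeminormedAddCommGroup E] [NormedSpace ℂ E] [MatrixNormed E]
  [NormedRing A] [NormedAlgebra ℂ A] [MatrixNormed A]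

theorem rnorm_mul_le [OperatorAlgebra A] (x : Matrix ι κ A) (y : Matrix κ ι' A) :
    rnorm (x * y) ≤ rnorm x * rnorm y := by
  have h : x * y = (odot x y).map (LinearMap.mul' ℂ A) := by
    ext i j
    simp [odot_apply, Matrix.mul_apply]
  rw [h]
  exact rnorm_map_odot_le _ OperatorAlgebra.mnorm_mul_le x y

/-- The right `A`-module structure of `E ⊗ A`, given by `(x ⊗ a) · b = x ⊗ ab`. -/
noncomputable instance : Module Aᵐᵒᵖ (HTensor E A) where
  smul b u := LinearMap.lTensor E (LinearMap.mulRight ℂ b.unop) (u : E ⊗[ℂ] A)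
  one_smul u := by
    have h : LinearMap.lTensor E (LinearMap.mulRight ℂ (1 : A)) = LinearMap.id := by
      rw [LinearMap.mulRight_one, LinearMap.lTensor_id]
    exact DFunLike.congr_fun h u
  mul_smul b c u := by
    have h : LinearMap.lTensor E (LinearMap.mulRight ℂ (c.unop * b.unop)) =
        (LinearMap.lTensor E (LinearMap.mulRight ℂ b.unop)).comp
          (LinearMap.lTensor E (LinearMap.mulRight ℂ c.unop)) := by
      rw [LinearMap.mulRight_mul, LinearMap.lTensor_comp]
    exact DFunLike.congr_fun h u
  smul_zero b := map_zero (LinearMap.lTensor E (LinearMap.mulRight ℂ b.unop))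
  smul_add b := map_add (LinearMap.lTensor E (LinearMap.mulRight ℂ b.unop))
  add_smul b c u := by
    have h : LinearMap.lTensor E (LinearMap.mulRight ℂ (b.unop + c.unop)) =
        LinearMap.lTensor E (LinearMap.mulRight ℂ b.unop) +
          LinearMap.lTensor E (LinearMap.mulRight ℂ c.unop) := by
      rw [← LinearMap.lTensor_add]
      congr 1
      ext
      simp [mul_add]
    exact DFunLike.congr_fun h u
  zero_smul u := by
    have h : LinearMap.lTensor E (LinearMap.mulRight ℂ (0 : A)) = 0 := by
      rw [LinearMap.mulRight_zero_eq_zero, LinearMap.lTensor_zero]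
    exact DFunLike.congr_fun h u

/-- The elementary tensor `x ⊗ a`. -/
noncomputable def HTensor.tmul (x : E) (a : A) : HTensor E A := x ⊗ₜ[ℂ] a

theorem HTensor.op_smul_tmul (x : E) (a b : A) :
    op b • HTensor.tmul x a = HTensor.tmul x (a * b) := rfl

theorem HTensor.op_smul_def (b : A) (u : HTensor E A) :
    op b • u = LinearMap.lTensor E (LinearMap.mulRight ℂ b) (u : E ⊗[ℂ] A) := rfl

instance : IsScalarTower ℂ Aᵐᵒᵖ (HTensor E A) where
  smul_assoc c b u := by
    have h : LinearMap.lTensor E (LinearMap.mulRight ℂ (c • b.unop)) =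
        c • LinearMap.lTensor E (LinearMap.mulRight ℂ b.unop) := by
      rw [← LinearMap.lTensor_smul]
      congr 1
      ext
      simp
    exact DFunLike.congr_fun h u

theorem actionMap_tmul {M : Type*} [AddCommGroup M] [Module ℂ M] [Module Aᵐᵒᵖ M]
    [IsScalarTower ℂ Aᵐᵒᵖ M] (x : M) (a : A) : actionMap A M (x ⊗ₜ[ℂ] a) = op a • x := rfl

theorem map_actionMap_odot {M : Type*} [AddCommGroup M] [Module ℂ M] [Module Aᵐᵒᵖ M]
    [IsScalarTower ℂ Aᵐᵒᵖ M] (x : Matrix ι κ M) (b : Matrix κ ι' A) (i : ι) (j : ι') :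
    (odot x b).map (actionMap A M) i j = ∑ k, op (b k j) • x i k := by
  rw [Matrix.map_apply, odot_apply, map_sum]
  rfl

theorem actionMap_odot_hodot (x : Matrix ι κ E) (y : Matrix κ κ' A) (b : Matrix κ' ι' A) :
    (odot (hodot x y) b).map (actionMap A (HTensor E A)) = hodot x (y * b) := by
  ext i j
  rw [map_actionMap_odot]
  have h1 : ∀ k, op (b k j) • hodot x y i k =
      (∑ l, x i l ⊗ₜ[ℂ] (y l k * b k j) : E ⊗[ℂ] A) := fun k => by
    have h : LinearMap.lTensor E (LinearMap.mulRight ℂ (b k j))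
      (∑ l, x i l ⊗ₜ[ℂ] y l k : E ⊗[ℂ] A) = ∑ l, x i l ⊗ₜ[ℂ] (y l k * b k j) := by
      simp [map_sum]
    exact h
  have h2 : (∑ k, ∑ l, x i l ⊗ₜ[ℂ] (y l k * b k j) : E ⊗[ℂ] A) = odot x (y * b) i j := by
    simp only [odot_apply, Matrix.mul_apply, TensorProduct.tmul_sum]
    exact Finset.sum_comm
  exact (Finset.sum_congr rfl fun k _ => h1 k).trans h2

theorem mnorm_action_HTensor_le [OperatorAlgebra A] {n p : ℕ}
    (U : Matrix (Fin n) (Fin p) (HTensor E A)) (b : Matrix (Fin p) (Fin n) A) :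
    mnorm ((odot U b).map (actionMap A (HTensor E A))) ≤ rnorm U * rnorm b := by
  have hU := rnorm_nonneg U
  have hb := rnorm_nonneg b
  have key : ∀ δ : ℝ, 0 < δ →
      mnorm ((odot U b).map (actionMap A (HTensor E A))) ≤ (rnorm U + δ) * rnorm b := by
    intro δ hδ
    have e1 : √(rnorm U + δ) ^ 2 = rnorm U + δ := Real.sq_sqrt (by positivity)
    have hs : 0 < √(rnorm U + δ) := Real.sqrt_pos.2 (by positivity)
    obtain ⟨q, x, y, h, hx, hy⟩ := exists_hfactor (u := pad U) hs
      (by rw [e1]; change rnorm U < _; linarith)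
    rw [← e1]
    generalize √(rnorm U + δ) = s at *
    have hU' := pad_inl_inr U
    rw [h] at hU'
    have hU2 : U = hodot (((s : ℂ) • x).submatrix
        (fun i => Fintype.equivFin (Fin n ⊕ Fin p) (Sum.inl i)) (Equiv.refl _))
        (((s : ℂ) • y).submatrix (Equiv.refl _)
          (fun i => Fintype.equivFin (Fin n ⊕ Fin p) (Sum.inr i))) := by
      rw [hodot_submatrix]
      exact hU'.symm
    have hsx : rnorm ((s : ℂ) • x) ≤ s := by
      refine (rnorm_smul_le _ _).trans ?_
      rw [Complex.norm_real, Real.norm_of_nonneg hs.le]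
      exact mul_le_of_le_one_right hs.le hx
    have hsy : rnorm ((s : ℂ) • y) ≤ s := by
      refine (rnorm_smul_le _ _).trans ?_
      rw [Complex.norm_real, Real.norm_of_nonneg hs.le]
      exact mul_le_of_le_one_right hs.le hy
    conv_lhs => rw [hU2, actionMap_odot_hodot]
    refine (mnorm_hodot_le _ _).trans ?_
    refine (mul_le_mul ((rnorm_submatrix_le _ injL (Equiv.injective _)).trans hsx)
      ((rnorm_mul_le _ _).trans (mul_le_mul_of_nonneg_right
        ((rnorm_submatrix_le _ (Equiv.injective _) injR).trans hsy) hb))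
      (rnorm_nonneg _) hs.le).trans (le_of_eq (by ring))
  refine le_of_forall_pos_le_add fun ε hε => ?_
  refine (key (ε / (rnorm b + 1)) (by positivity)).trans ?_
  have : ε / (rnorm b + 1) * rnorm b ≤ ε := by
    rw [div_mul_eq_mul_div, div_le_iff₀ (by positivity)]
    nlinarith
  linarith

theorem norm_op_smul_HTensor_le [OperatorAlgebra A] (u : HTensor E A) (b : A) :
    ‖op b • u‖ ≤ ‖b‖ * ‖u‖ := by
  have h := mnorm_action_HTensor_le (Matrix.of fun _ _ : Fin 1 => u) (Matrix.of fun _ _ : Fin 1 => b)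
  rw [mnorm_one, rnorm_eq_mnorm, rnorm_eq_mnorm, mnorm_one, mnorm_one, map_actionMap_odot] at h
  simpa [mul_comm] using h

instance [OperatorAlgebra A] : UniformContinuousConstSMul Aᵐᵒᵖ (HTensor E A) where
  uniformContinuous_const_smul b := by
    have h : LipschitzWith ‖b.unop‖₊ (fun u : HTensor E A => b • u) := by
      refine LipschitzWith.of_dist_le_mul fun u v => ?_
      rw [dist_eq_norm, dist_eq_norm, ← smul_sub]
      exact norm_op_smul_HTensor_le _ _
    exact h.uniformContinuous

/-- The Haagerup tensor product `E ⊗_h A` of operator spaces: the completion of the algebraic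
tensor product with the Haagerup matrix norms. -/
abbrev Haagerup (E F : Type*) [SeminormedAddCommGroup E] [NormedSpace ℂ E] [MatrixNormed E]
    [SeminormedAddCommGroup F] [NormedSpace ℂ F] [MatrixNormed F] : Type _ :=
  UniformSpace.Completion (HTensor E F)

/-- The elementary tensor `x ⊗ a` in `E ⊗_h A`. -/
noncomputable def Haagerup.tmul (x : E) (a : A) : Haagerup E A :=
  (HTensor.tmul x a : UniformSpace.Completion (HTensor E A))

theorem Haagerup.op_smul_tmul [OperatorAlgebra A] (x : E) (a b : A) :
    op b • (Haagerup.tmul x a : Haagerup E A) = Haagerup.tmul x (a * b) :=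
  (UniformSpace.Completion.coe_smul (op b) (HTensor.tmul x a)).symm

theorem map_actionMap_cmap [OperatorAlgebra A] (x : Matrix ι κ (HTensor E A))
    (b : Matrix κ ι' A) : (odot (cmap x) b).map (actionMap A (Haagerup E A)) =
      cmap ((odot x b).map (actionMap A (HTensor E A))) := by
  ext i j
  have e : cmap ((odot x b).map (actionMap A (HTensor E A))) i j =
    (((odot x b).map (actionMap A (HTensor E A)) i j : HTensor E A) : Haagerup E A) := rfl
  rw [map_actionMap_odot, e, map_actionMap_odot]
  have h := map_sum (UniformSpace.Completion.toComplL (𝕜 := ℂ) (E := HTensor E A))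
    (fun k => op (b k j) • x i k) Finset.univ
  refine Eq.trans ?_ h.symm
  exact Finset.sum_congr rfl fun k _ => (UniformSpace.Completion.coe_smul _ _).symm

theorem continuous_map_actionMap [OperatorAlgebra A] (b : Matrix κ ι' A) :
    Continuous fun X : Matrix ι κ (Haagerup E A) =>
      (odot X b).map (actionMap A (Haagerup E A)) := by
  refine continuous_matrix fun i j => ?_
  simp only [map_actionMap_odot]
  exact continuous_finsetSum _ fun k _ =>
    (continuous_const_smul _).comp (continuous_id.matrix_elem i k)

theorem mnorm_action_Haagerup_le [OperatorAlgebra A] {n p : ℕ}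
    (X : Matrix (Fin n) (Fin p) (Haagerup E A)) (b : Matrix (Fin p) (Fin n) A) :
    mnorm ((odot X b).map (actionMap A (Haagerup E A))) ≤ rnorm X * rnorm b := by
  refine cmap_denseRange.induction_on
    (p := fun X : Matrix (Fin n) (Fin p) (Haagerup E A) =>
      mnorm ((odot X b).map (actionMap A (Haagerup E A))) ≤ rnorm X * rnorm b) X
    (isClosed_le (uniformContinuous_mnorm.continuous.comp (continuous_map_actionMap b))
      (continuous_rnorm.mul continuous_const)) fun x => ?_
  rw [map_actionMap_cmap, mnorm_cmap, rnorm_cmap]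
  exact mnorm_action_HTensor_le x b

instance [OperatorAlgebra A] : OperatorModule A (Haagerup E A) where
  mnorm_action_le u := by
    refine le_csInf (hnorm_nonempty u) ?_
    rintro _ ⟨p, X, b, rfl, rfl⟩
    exact mnorm_action_Haagerup_le X b

end Algebras

section CompletelyBounded

variable {E F G : Type*} [SeminormedAddCommGroup E] [NormedSpace ℂ E] [MatrixNormed E]
  [SeminormedAddCommGroup F] [NormedSpace ℂ F] [MatrixNormed F]
  [SeminormedAddCommGroup G] [NormedSpace ℂ G] [MatrixNormed G]

/-- Complete boundedness of a linear map `f`: its amplifications `f_n : M_n(E) → M_n(F)` are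
bounded by a common constant. -/
def IsCB (f : E →ₗ[ℂ] F) : Prop :=
  ∃ C : ℝ, ∀ (n : ℕ) (x : Matrix (Fin n) (Fin n) E), mnorm (x.map f) ≤ C * mnorm x

theorem IsCB.id : IsCB (LinearMap.id : E →ₗ[ℂ] E) :=
  ⟨1, fun n x => by
    rw [one_mul]
    exact le_of_eq (congrArg _ (by ext; rfl))⟩

theorem IsCB.zero : IsCB (0 : E →ₗ[ℂ] F) :=
  ⟨0, fun n x => by
    have h : x.map (0 : E →ₗ[ℂ] F) = 0 := by ext; rfl
    rw [h, mnorm_zero, zero_mul]⟩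

theorem IsCB.add {f g : E →ₗ[ℂ] F} (hf : IsCB f) (hg : IsCB g) : IsCB (f + g) := by
  obtain ⟨C, hC⟩ := hf
  obtain ⟨D, hD⟩ := hg
  refine ⟨C + D, fun n x => ?_⟩
  have h : x.map (f + g) = x.map f + x.map g := by ext; rfl
  rw [h, add_mul]
  exact (mnorm_add_le _ _).trans (add_le_add (hC n x) (hD n x))

theorem IsCB.neg {f : E →ₗ[ℂ] F} (hf : IsCB f) : IsCB (-f) := by
  obtain ⟨C, hC⟩ := hf
  refine ⟨C, fun n x => ?_⟩
  have h : x.map (-f) = -x.map f := by ext; rfl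
  rw [h, ← rnorm_eq_mnorm, rnorm_neg, rnorm_eq_mnorm]
  exact hC n x

theorem IsCB.comp {g : F →ₗ[ℂ] G} {f : E →ₗ[ℂ] F} (hg : IsCB g) (hf : IsCB f) :
    IsCB (g.comp f) := by
  obtain ⟨C, hC⟩ := hf
  obtain ⟨D, hD⟩ := hg
  refine ⟨max D 0 * C, fun n x => ?_⟩
  have h : x.map (g.comp f) = (x.map f).map g := by ext; rfl
  rw [h, mul_assoc]
  refine (hD n _).trans ?_
  exact (mul_le_mul_of_nonneg_right (le_max_left D 0) (mnorm_nonneg _)).trans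
    (mul_le_mul_of_nonneg_left (hC n x) (le_max_right D 0))

variable (E F)

/-- The completely bounded linear maps `E → F`. -/
def CB : AddSubgroup (E →ₗ[ℂ] F) where
  carrier := {f | IsCB f}
  zero_mem' := IsCB.zero
  add_mem' := IsCB.add
  neg_mem' := IsCB.neg

/-- The completely bounded right `A`-module maps `E → F`. -/
def CBMod (A : Type*) [Ring A] [Module Aᵐᵒᵖ E] [Module Aᵐᵒᵖ F] : AddSubgroup (E →ₗ[ℂ] F) where
  carrier := {f | IsCB f ∧ ∀ (a : A) (x : E), f (MulOpposite.op a • x) = MulOpposite.op a • f x}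
  zero_mem' := ⟨IsCB.zero, fun a x => by simp⟩
  add_mem' := fun hf hg => ⟨hf.1.add hg.1, fun a x => by simp [hf.2, hg.2]⟩
  neg_mem' := fun hf => ⟨hf.1.neg, fun a x => by simp [hf.2]⟩

end CompletelyBounded

section Categories

open CategoryTheory Limits

/-- The objects of `Op`: operator spaces (complete, with matrix norms satisfying Ruan's axioms). -/
structure OpSpace : Type (u + 1) where
  carrier : Type u
  [normedAddCommGroup : NormedAddCommGroup carrier]
  [normedSpace : NormedSpace ℂ carrier]
  [completeSpace : CompleteSpace carrier]
  [matrixNormed : MatrixNormed carrier]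

attribute [instance] OpSpace.normedAddCommGroup OpSpace.normedSpace OpSpace.completeSpace
  OpSpace.matrixNormed

/-- The category `Op` of operator spaces and completely bounded linear maps. -/
instance : Category.{u} OpSpace.{u} where
  Hom E F := CB E.carrier F.carrier
  id E := ⟨LinearMap.id, IsCB.id⟩
  comp f g := ⟨g.1.comp f.1, g.2.comp f.2⟩

instance : Preadditive OpSpace.{u} where
  homGroup E F := inferInstanceAs (AddCommGroup (CB E.carrier F.carrier))
  add_comp _ _ _ f f' g := Subtype.ext (LinearMap.comp_add f.1 f'.1 g.1)
  comp_add _ _ _ f g g' := Subtype.ext (LinearMap.add_comp f.1 g'.1 g.1)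

variable (A : Type u) [NormedRing A] [NormedAlgebra ℂ A] [MatrixNormed A]

/-- The objects of `OMOD_A` for a unital operator algebra `A`: right operator `A`-modules. They
are unital, as `Module Aᵐᵒᵖ` contains `x · 1 = x`; so they are non-degenerate. -/
structure OMod : Type (u + 1) where
  carrier : Type u
  [normedAddCommGroup : NormedAddCommGroup carrier]
  [normedSpace : NormedSpace ℂ carrier]
  [completeSpace : CompleteSpace carrier]
  [matrixNormed : MatrixNormed carrier]
  [module : Module Aᵐᵒᵖ carrier]
  [isScalarTower : IsScalarTower ℂ Aᵐᵒᵖ carrier]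
  [operatorModule : OperatorModule A carrier]

attribute [instance] OMod.normedAddCommGroup OMod.normedSpace OMod.completeSpace
  OMod.matrixNormed OMod.module OMod.isScalarTower OMod.operatorModule

/-- The category `OMOD_A` of right operator `A`-modules and completely bounded `A`-module maps. -/
instance : Category.{u} (OMod A) where
  Hom E F := CBMod E.carrier F.carrier A
  id E := ⟨LinearMap.id, IsCB.id, fun _ _ => rfl⟩
  comp f g := ⟨g.1.comp f.1, g.2.1.comp f.2.1, fun a x => by
    rw [LinearMap.comp_apply, f.2.2, g.2.2, LinearMap.comp_apply]⟩

instance : Preadditive (OMod A) where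
  homGroup E F := inferInstanceAs (AddCommGroup (CBMod E.carrier F.carrier A))
  add_comp _ _ _ f f' g := Subtype.ext (LinearMap.comp_add f.1 f'.1 g.1)
  comp_add _ _ _ f g g' := Subtype.ext (LinearMap.add_comp f.1 g'.1 g.1)

/-- The forgetful functor from `OMOD_A` to `Op`. -/
def forgetOp : OMod A ⥤ OpSpace.{u} where
  obj E := { carrier := E.carrier }
  map f := ⟨f.1, f.2.1⟩

instance : (forgetOp A).Additive where
  map_add := rfl

/-- `(μ, π)` is a kernel-cokernel pair: `μ` is a kernel of `π` and `π` is a cokernel of `μ`. -/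
def IsKernelCokernelPair {C : Type*} [Category C] [HasZeroMorphisms C] (S : ShortComplex C) :
    Prop :=
  Nonempty (IsLimit (KernelFork.ofι S.f S.zero)) ∧
    Nonempty (IsColimit (CokernelCofork.ofπ S.g S.zero))

/-- The class `E_rel` of the kernel-cokernel pairs in `OMOD_A` that split in `Op`. -/
def relPairs : Set (ShortComplex (OMod A)) :=
  {S | IsKernelCokernelPair S ∧ Nonempty (S.map (forgetOp A)).Splitting}

/-- The admissible epimorphisms of a class of kernel-cokernel pairs: the morphisms `π` for which
there is a morphism `μ` such that `(μ, π)` belongs to the class. -/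
def admissibleEpi {C : Type*} [Category C] [HasZeroMorphisms C] (𝓔 : Set (ShortComplex C)) :
    MorphismProperty C :=
  fun E _ π => ∃ (K : C) (μ : K ⟶ E) (w : μ ≫ π = 0), ShortComplex.mk μ π w ∈ 𝓔

/-- `P`-projectivity of an object for a class `P` of morphisms: every morphism from the object to
`F` lifts along every `π : E ⟶ F` in `P`. -/
def IsRelProjective {C : Type*} [Category C] (P : MorphismProperty C) (X : C) : Prop :=
  ∀ ⦃E F : C⦄ (π : E ⟶ F), P π → ∀ f : X ⟶ F, ∃ g : X ⟶ E, g ≫ π = f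

/-- Enough `P`-projectives: every object `E` admits a morphism `X ⟶ E` in `P` from a
`P`-projective object `X`. -/
def EnoughRelProjectives {C : Type*} [Category C] (P : MorphismProperty C) : Prop :=
  ∀ E : C, ∃ X : C, IsRelProjective P X ∧ ∃ π : X ⟶ E, P π

/-- The Haagerup tensor product `E ⊗_h A`, as a right operator `A`-module with the action
`(x ⊗ a) · b = x ⊗ ab`. -/
noncomputable def haagerupMod [OperatorAlgebra A] (E : OpSpace.{u}) : OMod A where
  carrier := Haagerup E.carrier A

end Categories

end OperatorModules

/-
`E ⊗_h A` is the free right operator `A`-module on the operator space `E`: it is the value at `E` of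
a left adjoint of the forgetful functor `OMOD_A → Op`. Indeed, a completely bounded map `h : E → M`
into a module extends to `x ⊗ a ↦ h x · a`, which is completely bounded because `⊗_h` is functorial
for completely bounded maps and the action `M ⊗_h A → M` is completely contractive, and `h` is
recovered along the completely bounded map `x ↦ x ⊗ 1`.

A short complex of `OMOD_A` that splits in `Op` is automatically a kernel-cokernel pair, because the
splitting maps factor morphisms through its ends. So `P_rel` consists of the morphisms that have a
completely bounded linear section. Through the adjunction, free modules lift along such morphisms,
and the counit `E ⊗_h A → E` has the unit as a section in `Op`.
-/

namespace OperatorModules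

open MatrixNormed MulOpposite UniformSpace

section CompletelyBoundedMaps

variable {E F : Type*} [SeminormedAddCommGroup E] [NormedSpace ℂ E]
  [SeminormedAddCommGroup F] [NormedSpace ℂ F]

theorem pad_map (f : E →ₗ[ℂ] F) {ι κ : Type} [Fintype ι] [Fintype κ] (x : Matrix ι κ E) :
    pad (x.map f) = (pad x).map f := by
  classical rw [pad_eq_lr, pad_eq_lr, lr_map]

variable [MatrixNormed E] [MatrixNormed F] {f : E →ₗ[ℂ] F}

theorem IsCB.exists_rnorm_map_le (hf : IsCB f) :
    ∃ C : ℝ, 0 ≤ C ∧ ∀ {ι κ : Type} [Fintype ι] [Fintype κ] (x : Matrix ι κ E),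
      rnorm (x.map f) ≤ C * rnorm x := by
  obtain ⟨C, hC⟩ := hf
  refine ⟨max C 0, le_max_right C 0, fun x => ?_⟩
  rw [rnorm, pad_map]
  exact (hC _ _).trans (mul_le_mul_of_nonneg_right (le_max_left C 0) (mnorm_nonneg _))

theorem IsCB.exists_norm_le (hf : IsCB f) : ∃ C : ℝ, ∀ x, ‖f x‖ ≤ C * ‖x‖ := by
  obtain ⟨C, hC⟩ := hf
  refine ⟨C, fun x => ?_⟩
  have h := hC 1 (Matrix.of fun _ _ => x)
  rwa [mnorm_one, mnorm_one] at h

theorem IsCB.continuous (hf : IsCB f) : Continuous f :=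
  let ⟨C, hC⟩ := hf.exists_norm_le
  AddMonoidHomClass.continuous_of_bound f C hC

end CompletelyBoundedMaps

section Extension

variable {V M : Type*} [SeminormedAddCommGroup V] [NormedSpace ℂ V] [MatrixNormed V]
  [NormedAddCommGroup M] [NormedSpace ℂ M] [CompleteSpace M] [MatrixNormed M] {f : V →ₗ[ℂ] M}

/-- The extension of a completely bounded map to the completion of its domain. -/
noncomputable def IsCB.extend (hf : IsCB f) : Completion V →L[ℂ] M :=
  (⟨f, hf.continuous⟩ : V →L[ℂ] M).extend (Completion.toComplL (𝕜 := ℂ) (E := V))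

theorem IsCB.extend_coe (hf : IsCB f) (v : V) : hf.extend (v : Completion V) = f v :=
  ContinuousLinearMap.extend_eq _ Completion.denseRange_coe (Completion.isUniformInducing_coe V) v

theorem IsCB.isCB_extend (hf : IsCB f) : IsCB (hf.extend : Completion V →ₗ[ℂ] M) := by
  refine Exists.imp (fun C hC n x => ?_) hf
  have isClosed : IsClosed {x : Matrix (Fin n) (Fin n) (Completion V) |
      mnorm (x.map hf.extend) ≤ C * mnorm x} :=
    isClosed_le (uniformContinuous_mnorm.continuous.comp
      (continuous_id.matrix_map hf.extend.continuous))
      (continuous_const.mul uniformContinuous_mnorm.continuous)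
  refine cmap_denseRange.induction_on x isClosed fun x => ?_
  have map_cmap : (cmap x).map hf.extend = x.map f := Matrix.ext fun i j => hf.extend_coe (x i j)
  rw [ContinuousLinearMap.coe_coe, map_cmap, mnorm_cmap]
  exact hC n x

end Extension

section HaagerupFunctoriality

variable {E F E' F' G : Type*} [SeminormedAddCommGroup E] [NormedSpace ℂ E]
  [SeminormedAddCommGroup F] [NormedSpace ℂ F] [SeminormedAddCommGroup E'] [NormedSpace ℂ E']
  [SeminormedAddCommGroup F'] [NormedSpace ℂ F'] [SeminormedAddCommGroup G] [NormedSpace ℂ G]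

/-- The map `x ⊗ y ↦ f x ⊗ g y` between algebraic tensor products with the Haagerup matrix
norms. -/
noncomputable def HTensor.map (f : E →ₗ[ℂ] E') (g : F →ₗ[ℂ] F') :
    HTensor E F →ₗ[ℂ] HTensor E' F' :=
  TensorProduct.map f g

theorem map_hodot (f : E →ₗ[ℂ] E') (g : F →ₗ[ℂ] F') {ι κ ι' : Type} [Fintype κ]
    (x : Matrix ι κ E) (y : Matrix κ ι' F) :
    (hodot x y).map (HTensor.map f g) = hodot (x.map f) (y.map g) :=
  Matrix.ext fun i j => map_sum (TensorProduct.map f g) (fun k => x i k ⊗ₜ[ℂ] y k j) Finset.univ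

variable [MatrixNormed E] [MatrixNormed F] [MatrixNormed E'] [MatrixNormed F'] [MatrixNormed G]

theorem isCB_of_forall_hodot {f : HTensor E F →ₗ[ℂ] G} {C : ℝ} (hC : 0 ≤ C)
    (h : ∀ {n p : ℕ} (x : Matrix (Fin n) (Fin p) E) (y : Matrix (Fin p) (Fin n) F),
      mnorm ((hodot x y).map f) ≤ C * (rnorm x * rnorm y)) : IsCB f := by
  refine ⟨C, fun n (u : Matrix (Fin n) (Fin n) (E ⊗[ℂ] F)) => ?_⟩
  change _ ≤ C • hnorm u
  unfold hnorm
  rw [← Real.sInf_smul_of_nonneg hC]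
  refine le_csInf (hnorm_nonempty u).smul_set ?_
  rintro _ ⟨_, ⟨p, x, y, rfl, rfl⟩, rfl⟩
  exact h x y

theorem IsCB.hTensorMap {f : E →ₗ[ℂ] E'} {g : F →ₗ[ℂ] F'} (hf : IsCB f) (hg : IsCB g) :
    IsCB (HTensor.map f g) := by
  obtain ⟨C, hC, hfC⟩ := hf.exists_rnorm_map_le
  obtain ⟨D, hD, hgD⟩ := hg.exists_rnorm_map_le
  refine isCB_of_forall_hodot (mul_nonneg hC hD) fun x y => ?_
  calc mnorm ((hodot x y).map (HTensor.map f g))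
    _ = mnorm (hodot (x.map f) (y.map g)) := by rw [map_hodot]
    _ ≤ rnorm (x.map f) * rnorm (y.map g) := mnorm_hodot_le _ _
    _ ≤ (C * rnorm x) * (D * rnorm y) :=
      mul_le_mul (hfC x) (hgD y) (rnorm_nonneg _) (mul_nonneg hC (rnorm_nonneg _))
    _ = C * D * (rnorm x * rnorm y) := mul_mul_mul_comm _ _ _ _

end HaagerupFunctoriality

section Unit

variable {E A : Type*} [SeminormedAddCommGroup E] [NormedSpace ℂ E]
  [NormedRing A] [NormedAlgebra ℂ A]

theorem hodot_diagonal_const {ι κ : Type} [Fintype κ] [DecidableEq κ] (x : Matrix ι κ E) (a : A) :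
    hodot x (Matrix.diagonal fun _ => a) = x.map fun v => HTensor.tmul v a := by
  ext i j
  refine (odot_apply _ _ _ _).trans
    ((Finset.sum_eq_single_of_mem j (Finset.mem_univ j) ?_).trans ?_)
  · intro k _ hkj
    rw [Matrix.diagonal_apply_ne _ hkj, tmul_zero]
  · rw [Matrix.diagonal_apply_eq]
    rfl

variable [MatrixNormed E] [MatrixNormed A]

theorem mnorm_diagonal_le {n : ℕ} (v : Fin n → E) : mnorm (Matrix.diagonal v) ≤ ‖v‖ := by
  induction n with
  | zero => rw [Subsingleton.elim (Matrix.diagonal v) 0, mnorm_zero]; exact norm_nonneg v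
  | succ n ih =>
    have diagonal_eq_dsum : Matrix.diagonal v =
        dsum (Matrix.diagonal (Fin.init v)) (Matrix.diagonal fun _ : Fin 1 => v (Fin.last n)) := by
      rw [dsum, Matrix.fromBlocks_diagonal, Matrix.submatrix_diagonal_equiv]
      congr 1
      funext i
      induction i using Fin.lastCases <;> simp [Fin.init]
    rw [diagonal_eq_dsum, mnorm_dsum, mnorm_one, Matrix.diagonal_apply_eq]
    have norm_init_le : ‖Fin.init v‖ ≤ ‖v‖ :=
      (pi_norm_le_iff_of_nonneg (norm_nonneg v)).2 fun i => norm_le_pi_norm v i.castSucc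
    exact max_le ((ih _).trans norm_init_le) (norm_le_pi_norm v _)

/-- The map `E → E ⊗_h A`, `x ↦ x ⊗ a`. -/
noncomputable def Haagerup.tmulRight (a : A) : E →ₗ[ℂ] Haagerup E A :=
  (Completion.toComplL (𝕜 := ℂ) (E := HTensor E A)).toLinearMap.comp
    (show E →ₗ[ℂ] HTensor E A from (TensorProduct.mk ℂ E A).flip a)

theorem Haagerup.isCB_tmulRight (a : A) : IsCB (tmulRight a : E →ₗ[ℂ] Haagerup E A) := by
  refine ⟨‖a‖, fun n x => ?_⟩
  have mnorm_diagonal_const_le : mnorm (Matrix.diagonal fun _ : Fin n => a) ≤ ‖a‖ :=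
    (mnorm_diagonal_le _).trans (pi_norm_const_le a)
  calc mnorm (x.map (tmulRight a))
    _ = mnorm (cmap (hodot x (Matrix.diagonal fun _ => a))) := by rw [hodot_diagonal_const]; rfl
    _ ≤ rnorm x * rnorm (Matrix.diagonal fun _ : Fin n => a) := by
      rw [mnorm_cmap]
      exact mnorm_hodot_le _ _
    _ ≤ ‖a‖ * mnorm x := by
      rw [rnorm_eq_mnorm, rnorm_eq_mnorm, mul_comm]
      exact mul_le_mul_of_nonneg_right mnorm_diagonal_const_le (mnorm_nonneg x)

theorem Haagerup.induction_on {p : Haagerup E A → Prop} (u : Haagerup E A)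
    (isClosed : IsClosed {u | p u}) (tmul : ∀ (x : E) (a : A), p (tmul x a))
    (add : ∀ u v, p u → p v → p (u + v)) : p u := by
  refine Completion.induction_on u isClosed fun v : E ⊗[ℂ] A => ?_
  induction v using TensorProduct.induction_on with
  | zero => simpa [Haagerup.tmul, HTensor.tmul] using tmul 0 0
  | tmul x a => exact tmul x a
  | add v w hv hw => exact Completion.coe_add (α := HTensor E A) v w ▸ add _ _ hv hw

end Unit

section Lift

variable {A M : Type*} [NormedRing A] [NormedAlgebra ℂ A] [MatrixNormed A]

theorem OperatorModule.isBoundedSMul [SeminormedAddCommGroup M] [NormedSpace ℂ M] [MatrixNormed M]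
    [Module Aᵐᵒᵖ M] [IsScalarTower ℂ Aᵐᵒᵖ M] [OperatorModule A M] : IsBoundedSMul Aᵐᵒᵖ M := by
  refine IsBoundedSMul.of_norm_smul_le fun b x => ?_
  have h := (OperatorModule.mnorm_action_le (A := A) _).trans
    (hnorm_odot_le (Matrix.of fun _ _ : Fin 1 => x) (Matrix.of fun _ _ : Fin 1 => b.unop))
  rw [rnorm_eq_mnorm, rnorm_eq_mnorm, mnorm_one, mnorm_one, mnorm_one, map_actionMap_odot,
    mul_comm] at h
  simpa [norm_unop] using h

theorem isCB_actionMap [SeminormedAddCommGroup M] [NormedSpace ℂ M] [MatrixNormed M]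
    [Module Aᵐᵒᵖ M] [IsScalarTower ℂ Aᵐᵒᵖ M] [OperatorModule A M] :
    IsCB (E := HTensor M A) (actionMap A M) :=
  ⟨1, fun _ u => (OperatorModule.mnorm_action_le u).trans_eq (one_mul (mnorm u)).symm⟩

variable {E : Type*} [SeminormedAddCommGroup E] [NormedSpace ℂ E] [MatrixNormed E]

theorem Haagerup.hom_ext [OperatorAlgebra A] [NormedAddCommGroup M] [NormedSpace ℂ M]
    [MatrixNormed M] [Module Aᵐᵒᵖ M] {f g : Haagerup E A →ₗ[ℂ] M}
    (hf : f ∈ CBMod (Haagerup E A) M A) (hg : g ∈ CBMod (Haagerup E A) M A)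
    (h : ∀ x : E, f (tmul x 1) = g (tmul x 1)) : f = g := by
  ext u
  induction u using Haagerup.induction_on with
  | isClosed => exact isClosed_eq hf.1.continuous hg.1.continuous
  | tmul x a => rw [← one_mul a, ← op_smul_tmul, hf.2, hg.2, h]
  | add u v hu hv => rw [map_add, map_add, hu, hv]

variable [NormedAddCommGroup M] [NormedSpace ℂ M] [MatrixNormed M]
  [Module Aᵐᵒᵖ M] [IsScalarTower ℂ Aᵐᵒᵖ M] [OperatorModule A M]

variable [CompleteSpace M] {h : E →ₗ[ℂ] M}

variable (A) in
/-- The completely bounded module map `E ⊗_h A → M`, `x ⊗ a ↦ h x · a`, induced by a completely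
bounded map `h : E → M` into a right operator module. -/
noncomputable def Haagerup.lift (hh : IsCB h) : Haagerup E A →L[ℂ] M :=
  (isCB_actionMap.comp (hh.hTensorMap (IsCB.id (E := A)))).extend

theorem Haagerup.lift_tmul (hh : IsCB h) (x : E) (a : A) : lift A hh (tmul x a) = op a • h x :=
  IsCB.extend_coe _ _

theorem Haagerup.lift_op_smul [OperatorAlgebra A] (hh : IsCB h) (b : A) (u : Haagerup E A) :
    lift A hh (op b • u) = op b • lift A hh u := by
  have : IsBoundedSMul Aᵐᵒᵖ M := OperatorModule.isBoundedSMul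
  induction u using Haagerup.induction_on with
  | isClosed =>
    exact isClosed_eq ((lift A hh).continuous.comp (continuous_const_smul _))
      ((lift A hh).continuous.const_smul _)
  | tmul x a => rw [op_smul_tmul, lift_tmul, lift_tmul, op_mul, mul_smul]
  | add u v hu hv => rw [smul_add, map_add, hu, hv, map_add, smul_add]

theorem Haagerup.lift_mem_CBMod [OperatorAlgebra A] (hh : IsCB h) :
    (lift A hh : Haagerup E A →ₗ[ℂ] M) ∈ CBMod (Haagerup E A) M A :=
  ⟨IsCB.isCB_extend _, lift_op_smul hh⟩

end Lift

section Submodules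

variable {R E : Type*} [SeminormedAddCommGroup E] [NormedSpace ℂ E] [MatrixNormed E] [Ring R]
  [SMul ℂ R] [Module R E] [IsScalarTower ℂ R E]

/-- The matrix norms that a submodule inherits from its ambient operator space. -/
instance (K : Submodule R E) : MatrixNormed K where
  mnorm x := mnorm (x.map K.subtype)
  mnorm_one x := mnorm_one (x.map K.subtype)
  mnorm_add_le x y := by
    rw [Matrix.map_add _ (map_add _)]
    exact mnorm_add_le _ _
  mnorm_lr_le α x β := by
    have map_lr : (lr α x β).map K.subtype = lr α (x.map K.subtype) β :=
      lr_map (K.subtype.restrictScalars ℂ) α x β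
    rw [map_lr]
    exact mnorm_lr_le _ _ _
  mnorm_dsum x y := by
    have map_dsum : (dsum x y).map K.subtype = dsum (x.map K.subtype) (y.map K.subtype) := by
      simp only [dsum, ← Matrix.submatrix_map, Matrix.fromBlocks_map,
        Matrix.map_zero _ (map_zero _)]
    rw [map_dsum]
    exact mnorm_dsum _ _

theorem mnorm_map_subtype (K : Submodule R E) {n : ℕ} (x : Matrix (Fin n) (Fin n) K) :
    mnorm (x.map K.subtype) = mnorm x := rfl

theorem rnorm_map_subtype (K : Submodule R E) {ι κ : Type} [Fintype ι] [Fintype κ]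
    (x : Matrix ι κ K) : rnorm (x.map K.subtype) = rnorm x :=
  congrArg mnorm (pad_map (K.subtype.restrictScalars ℂ) x)

theorem isCB_subtype (K : Submodule R E) : IsCB (K.subtype.restrictScalars ℂ) :=
  ⟨1, fun _ _ => (one_mul _).ge⟩

theorem IsCB.codRestrict {F : Type*} [SeminormedAddCommGroup F] [NormedSpace ℂ F]
    [MatrixNormed F] {f : F →ₗ[ℂ] E} (hf : IsCB f) (K : Submodule R E) (h : ∀ x, f x ∈ K) :
    IsCB (f.codRestrict (K.restrictScalars ℂ) h : F →ₗ[ℂ] K) :=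
  hf

end Submodules

instance {A E : Type*} [NormedRing A] [NormedAlgebra ℂ A] [MatrixNormed A]
    [SeminormedAddCommGroup E] [NormedSpace ℂ E] [MatrixNormed E] [Module Aᵐᵒᵖ E]
    [IsScalarTower ℂ Aᵐᵒᵖ E] [OperatorModule A E] (K : Submodule Aᵐᵒᵖ E) : OperatorModule A K where
  mnorm_action_le u := by
    refine le_csInf (hnorm_nonempty u) ?_
    rintro _ ⟨p, x, b, rfl, rfl⟩
    have map_action : ((odot x b).map (actionMap A K)).map K.subtype =
        (odot (x.map K.subtype) b).map (actionMap A E) := by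
      ext i j
      rw [Matrix.map_apply, map_actionMap_odot, map_actionMap_odot, map_sum]
      rfl
    rw [← mnorm_map_subtype, map_action, ← rnorm_map_subtype]
    exact (OperatorModule.mnorm_action_le _).trans (hnorm_odot_le _ _)

section RelativeStructure

open CategoryTheory Limits

variable {A : Type u} [NormedRing A] [NormedAlgebra ℂ A] [MatrixNormed A]

theorem OMod.hom_ext {E F : OMod A} {f g : E ⟶ F} (h : ∀ x, f.1 x = g.1 x) : f = g :=
  Subtype.ext (LinearMap.ext h)

theorem OMod.comp_eq_zero_iff {E F G : OMod A} {f : E ⟶ F} {g : F ⟶ G} :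
    f ≫ g = 0 ↔ ∀ x, g.1 (f.1 x) = 0 :=
  ⟨fun h x => congrArg (fun k : E ⟶ G => k.1 x) h,
    fun h => OMod.hom_ext (f := f ≫ g) (g := 0) h⟩

section Splitting

variable {S : ShortComplex (OMod A)} {r : S.X₂.carrier →ₗ[ℂ] S.X₁.carrier}
  {σ : S.X₃.carrier →ₗ[ℂ] S.X₂.carrier}

theorem nonempty_isLimit_of_splitting (hr : IsCB r) (r_f : ∀ x, r (S.f.1 x) = x)
    (f_r_add_σ_g : ∀ x, S.f.1 (r x) + σ (S.g.1 x) = x) :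
    Nonempty (IsLimit (KernelFork.ofι S.f S.zero)) := by
  have f_r_apply {W : OMod A} {k : W ⟶ S.X₂} (hk : k ≫ S.g = 0) (x : W.carrier) :
      S.f.1 (r (k.1 x)) = k.1 x := by
    simpa only [OMod.comp_eq_zero_iff.1 hk x, map_zero, add_zero] using f_r_add_σ_g (k.1 x)
  have f_injective : Function.Injective S.f.1 := Function.LeftInverse.injective r_f
  refine ⟨KernelFork.IsLimit.ofι _ _
    (fun k hk => ⟨r.comp k.1, hr.comp k.2.1, fun a x => f_injective ?_⟩)
    (fun k hk => OMod.hom_ext (f_r_apply hk))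
    (fun k hk m hm => OMod.hom_ext fun x => f_injective ?_)⟩
  · rw [S.f.2.2]
    exact (f_r_apply hk _).trans ((k.2.2 a x).trans (congrArg _ (f_r_apply hk x).symm))
  · exact (congrArg (fun j => j.1 x) hm).trans (f_r_apply hk x).symm

theorem nonempty_isColimit_of_splitting (hσ : IsCB σ) (g_σ : ∀ y, S.g.1 (σ y) = y)
    (f_r_add_σ_g : ∀ x, S.f.1 (r x) + σ (S.g.1 x) = x) :
    Nonempty (IsColimit (CokernelCofork.ofπ S.g S.zero)) := by
  have k_σ_g_apply {W : OMod A} {k : S.X₂ ⟶ W} (hk : S.f ≫ k = 0) (x : S.X₂.carrier) :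
      k.1 (σ (S.g.1 x)) = k.1 x := by
    simpa only [map_add, OMod.comp_eq_zero_iff.1 hk, zero_add] using
      congrArg k.1 (f_r_add_σ_g x)
  have g_surjective : Function.Surjective S.g.1 := Function.RightInverse.surjective g_σ
  refine ⟨CokernelCofork.IsColimit.ofπ _ _
    (fun k hk => ⟨k.1.comp σ, k.2.1.comp hσ, fun a y => ?_⟩)
    (fun k hk => OMod.hom_ext (k_σ_g_apply hk))
    (fun k hk m hm => OMod.hom_ext fun y => ?_)⟩
  · obtain ⟨x, rfl⟩ := g_surjective y
    rw [← S.g.2.2]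
    exact (k_σ_g_apply hk _).trans ((k.2.2 a x).trans (congrArg _ (k_σ_g_apply hk x).symm))
  · obtain ⟨x, rfl⟩ := g_surjective y
    exact (congrArg (fun j => j.1 x) hm).trans (k_σ_g_apply hk x).symm

end Splitting

theorem mem_relPairs_iff {S : ShortComplex (OMod A)} :
    S ∈ relPairs A ↔ Nonempty (S.map (forgetOp A)).Splitting := by
  refine ⟨And.right, fun ⟨s⟩ => ⟨?_, ⟨s⟩⟩⟩
  have f_r_add_s_g := DFunLike.congr_fun (congrArg Subtype.val s.id)
  exact ⟨nonempty_isLimit_of_splitting s.r.2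
      (DFunLike.congr_fun (congrArg Subtype.val s.f_r)) f_r_add_s_g,
    nonempty_isColimit_of_splitting s.s.2
      (DFunLike.congr_fun (congrArg Subtype.val s.s_g)) f_r_add_s_g⟩

/-- A morphism of `OMOD_A` as a linear map of right `A`-modules. -/
def OMod.toLinearMap {E F : OMod A} (π : E ⟶ F) : E.carrier →ₗ[Aᵐᵒᵖ] F.carrier where
  toFun := π.1
  map_add' := map_add π.1
  map_smul' a := π.2.2 a.unop

/-- The kernel of a morphism of `OMOD_A`, with the matrix norms of the domain. -/
noncomputable def OMod.ker {E F : OMod A} (π : E ⟶ F) : OMod A where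
  carrier := LinearMap.ker (OMod.toLinearMap π)
  completeSpace := (isClosed_singleton.preimage π.2.1.continuous).completeSpace_coe

/-- The short complex `ker π → E → F` of a morphism `π : E → F` of `OMOD_A`. -/
noncomputable def OMod.kerComplex {E F : OMod A} (π : E ⟶ F) : ShortComplex (OMod A) where
  X₁ := OMod.ker π
  f := ⟨(LinearMap.ker (OMod.toLinearMap π)).subtype.restrictScalars ℂ, isCB_subtype _,
    fun _ _ => rfl⟩
  g := π
  zero := OMod.comp_eq_zero_iff.2 Subtype.property

/-- The projection `x ↦ x - σ (π x)` of `E` onto `ker π` given by a linear section `σ` of a morphism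
`π : E → F` of `OMOD_A`. -/
def OMod.kerProjection {E F : OMod A} (π : E ⟶ F) (σ : F.carrier →ₗ[ℂ] E.carrier)
    (π_σ : ∀ y, π.1 (σ y) = y) : E.carrier →ₗ[ℂ] LinearMap.ker (OMod.toLinearMap π) :=
  (LinearMap.id + -σ.comp π.1).codRestrict
    ((LinearMap.ker (OMod.toLinearMap π)).restrictScalars ℂ) fun x => by
      change π.1 (x + -σ (π.1 x)) = 0
      rw [map_add, map_neg, π_σ, add_neg_cancel]

theorem OMod.kerComplex_mem_relPairs {E F : OMod A} (π : E ⟶ F) {σ : F.carrier →ₗ[ℂ] E.carrier}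
    (hσ : IsCB σ) (π_σ : ∀ y, π.1 (σ y) = y) : OMod.kerComplex π ∈ relPairs A := by
  have isCB_kerProjection : IsCB (OMod.kerProjection π σ π_σ) :=
    IsCB.codRestrict (IsCB.id.add (hσ.comp π.2.1).neg) _ _
  have kerProjection_apply (x : LinearMap.ker (OMod.toLinearMap π)) :
      OMod.kerProjection π σ π_σ x = x := by
    refine Subtype.ext ?_
    change x.1 + -σ (π.1 x.1) = x.1
    rw [show π.1 x.1 = 0 from x.2, map_zero, neg_zero, add_zero]
  exact mem_relPairs_iff.2 ⟨
    { r := ⟨OMod.kerProjection π σ π_σ, isCB_kerProjection⟩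
      s := ⟨σ, hσ⟩
      f_r := Subtype.ext (LinearMap.ext kerProjection_apply)
      s_g := Subtype.ext (LinearMap.ext π_σ)
      id := Subtype.ext (LinearMap.ext fun x : E.carrier =>
        neg_add_cancel_right x (σ (π.1 x))) }⟩

theorem admissibleEpi_relPairs_iff {E F : OMod A} {π : E ⟶ F} :
    admissibleEpi (relPairs A) π ↔ IsSplitEpi ((forgetOp A).map π) := by
  constructor
  · rintro ⟨_, _, _, _, ⟨s⟩⟩
    exact ⟨⟨s.s, s.s_g⟩⟩
  · rintro ⟨⟨σ, σ_π⟩⟩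
    exact ⟨_, _, (OMod.kerComplex π).zero, OMod.kerComplex_mem_relPairs π σ.2
      (DFunLike.congr_fun (congrArg Subtype.val σ_π))⟩

end RelativeStructure

section FreeModules

open CategoryTheory

theorem isRelProjective_leftAdjoint_obj {C D : Type*} [Category C] [Category D] {L : C ⥤ D}
    {U : D ⥤ C} (adj : L ⊣ U) {P : MorphismProperty D}
    (hP : ∀ ⦃Y Z : D⦄ (π : Y ⟶ Z), P π → IsSplitEpi (U.map π)) (X : C) :
    IsRelProjective P (L.obj X) := by
  intro Y Z π hπ f
  have := hP π hπ
  refine ⟨(adj.homEquiv X Y).symm (adj.homEquiv X Z f ≫ section_ (U.map π)), ?_⟩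
  rw [← adj.homEquiv_naturality_right_symm, Category.assoc, IsSplitEpi.id, Category.comp_id,
    Equiv.symm_apply_apply]

theorem isSplitEpi_map_counit_app {C D : Type*} [Category C] [Category D] {L : C ⥤ D}
    {U : D ⥤ C} (adj : L ⊣ U) (Y : D) : IsSplitEpi (U.map (adj.counit.app Y)) :=
  ⟨⟨adj.unit.app (U.obj Y), adj.right_triangle_components Y⟩⟩

variable (A : Type u) [NormedRing A] [NormedAlgebra ℂ A] [MatrixNormed A] [OperatorAlgebra A]

/-- The universal property of `E ⊗_h A`: its morphisms to `M` in `OMOD_A` correspond to the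
completely bounded maps `E → M`, by restriction along `x ↦ x ⊗ 1`. -/
noncomputable def haagerupHomEquiv (E : OpSpace.{u}) (M : OMod A) :
    (haagerupMod A E ⟶ M) ≃ (E ⟶ (forgetOp A).obj M) where
  toFun f := ⟨f.1.comp (Haagerup.tmulRight 1), f.2.1.comp (Haagerup.isCB_tmulRight 1)⟩
  invFun h :=
    have hh : IsCB (F := M.carrier) h.1 := h.2
    ⟨(Haagerup.lift A hh).toLinearMap, Haagerup.lift_mem_CBMod hh⟩
  left_inv f := Subtype.ext (Haagerup.hom_ext (Haagerup.lift_mem_CBMod _) f.2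
    fun x => (Haagerup.lift_tmul _ x 1).trans (one_smul _ _))
  right_inv h :=
    have hh : IsCB (F := M.carrier) h.1 := h.2
    Subtype.ext (LinearMap.ext fun x => (Haagerup.lift_tmul hh x 1).trans (one_smul Aᵐᵒᵖ _))

/-- The functor `E ↦ E ⊗_h A` from `Op` to `OMOD_A`. -/
noncomputable def haagerupFunctor : OpSpace.{u} ⥤ OMod A :=
  Adjunction.leftAdjointOfEquiv (haagerupHomEquiv A) fun _ _ _ _ _ => rfl

/-- `E ⊗_h A` is the free right operator `A`-module on the operator space `E`. -/
noncomputable def haagerupAdjunction : haagerupFunctor A ⊣ forgetOp A :=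
  Adjunction.adjunctionOfEquivLeft (haagerupHomEquiv A) _

variable {A}

/-- The canonical morphism `E ⊗_h A → E` of `OMOD_A`. -/
noncomputable def haagerupCounit (E : OMod A) : haagerupMod A ((forgetOp A).obj E) ⟶ E :=
  (haagerupAdjunction A).counit.app E

theorem haagerupCounit_tmul (E : OMod A) (x : E.carrier) (a : A) :
    (haagerupCounit E).1 (Haagerup.tmul x a) = op a • x :=
  Haagerup.lift_tmul (M := E.carrier) IsCB.id x a

theorem isRelProjective_haagerupMod (E : OpSpace.{u}) :
    IsRelProjective (admissibleEpi (relPairs A)) (haagerupMod A E) :=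
  isRelProjective_leftAdjoint_obj (haagerupAdjunction A)
    (fun _ _ _ => admissibleEpi_relPairs_iff.1) E

theorem admissibleEpi_haagerupCounit (E : OMod A) :
    admissibleEpi (relPairs A) (haagerupCounit E) :=
  admissibleEpi_relPairs_iff.2 (isSplitEpi_map_counit_app (haagerupAdjunction A) E)

end FreeModules

end OperatorModules

open OperatorModules CategoryTheory in
theorem mainTheorem5_general {A : Type u} [NormedRing A] [NormedAlgebra ℂ A] [MatrixNormed A]
    [OperatorAlgebra A] :
    (∀ E : OpSpace.{u}, IsRelProjective (admissibleEpi (relPairs A)) (haagerupMod A E)) ∧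
    (∀ E : OMod A, ∃ P : haagerupMod A ((forgetOp A).obj E) ⟶ E,
      (∀ (x : E.carrier) (a : A), P.1 (Haagerup.tmul x a) = MulOpposite.op a • x) ∧
      admissibleEpi (relPairs A) P) ∧
    EnoughRelProjectives (admissibleEpi (relPairs A)) :=
  ⟨isRelProjective_haagerupMod,
    fun E => ⟨haagerupCounit E, haagerupCounit_tmul E, admissibleEpi_haagerupCounit E⟩,
    fun E => ⟨_, isRelProjective_haagerupMod _, haagerupCounit E, admissibleEpi_haagerupCounit E⟩⟩

open OperatorModules CategoryTheory in
/-- For a unital operator algebra `A` and an operator space `E`, the module `E ⊗_h A` is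
`P_rel`-projective; for `E` in `OMOD_A` the canonical map `E ⊗_h A ⟶ E`, `x ⊗ a ↦ x · a`, is a
morphism of `OMOD_A` and an admissible epimorphism of `E_rel`; and `(OMOD_A, E_rel)` has enough
`P_rel`-projectives. -/
theorem mainTheorem5 {A : Type u} [NormedRing A] [NormedAlgebra ℂ A] [CompleteSpace A]
    [MatrixNormed A] [OperatorAlgebra A] :
    (∀ E : OpSpace.{u}, IsRelProjective (admissibleEpi (relPairs A)) (haagerupMod A E)) ∧
    (∀ E : OMod A, ∃ P : haagerupMod A ((forgetOp A).obj E) ⟶ E,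
      (∀ (x : E.carrier) (a : A), P.1 (Haagerup.tmul x a) = MulOpposite.op a • x) ∧
      admissibleEpi (relPairs A) P) ∧
    EnoughRelProjectives (admissibleEpi (relPairs A)) := by
  exact mainTheorem5_general
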